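/- Let $g:\mathbb R\to\mathbb R$ be continuously differentiable with $g(0)=0$ and $g'(s)=O(s^2)$ as $s\to0$, let $m\in\mathbb Z$, $\sigma>0$, and let $w:[0,\infty)\to\mathbb R$ be continuous and exponentially decaying, i.e. $|w(r)|\le Ce^{-\kappa r}$ for all $r\ge0$ with some constants $C$ and $\kappa>0$. Put $$\alpha(s)=\tfrac12\Bigl[g'(s)+\frac{g(s)}s\Bigr],\qquad \beta(s)=\tfrac12\Bigl[g'(s)-\frac{g(s)}s\Bigr]\quad(s\ne0),\qquad \alpha(0)=\beta(0)=0,$$ $$J=\begin{pmatrix}0&-1\\1&0\end{pmatrix},\qquad R=\begin{pmatrix}1&0\\0&-1\end{pmatrix},$$ and let $(r,\theta)$ be polar coordinates on $\mathbb R^2$. Consider the unbounded operators $$A=J\bigl(\Delta-\sigma^2+\alpha(w(r))+\beta(w(r))e^{2m\theta J}R\bigr),\qquad A_0=J(\Delta-\sigma^2)$$ on (the complexification $L^2(\mathbb R^2,\mathbb C^2)$ of) $L^2(\mathbb R^2,\mathbb R^2)$, with domain the Sobolev space $H^2$. (For $w$ such that $e^{i\sigma^2t}e^{im\theta}w(r)$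 is a standing wave of the nonlinear Schrödinger equation whose nonlinearity has real restriction $g$, $A$ is the linearization about that wave.) For such an operator $T$ let $\operatorname{spec}(T)$ be the set of $\lambda\in\mathbb C$ for which $\lambda-T$ has no bounded everywhere defined inverse. The discrete spectrum $\operatorname{spec}_{\rm disc}(T)$ is the set of eigenvalues of $T$ that are isolated points of $\operatorname{spec}(T)$ and have finite algebraic multiplicity, i.e. whose Riesz projection $\frac1{2\pi i}\oint(z-T)^{-1}\,dz$ (over a small circle around the eigenvalue) has finite rank. The essential spectrum is the rest, $\operatorname{spec}_{\rm ess}(T)=\operatorname{spec}(T)\setminus\operatorname{spec}_{\rm disc}(T)$. Then the spectrum of $A$ is the union of its discrete and essential spectrum. The latter is purely imaginary and is given by $$\operatorname{spec}_{\rm ess}(A)=\operatorname{spec}(A_0)=\{it\mid t\in\mathbb R,\ |t|\ge\sigma^2\}.$$ -/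

import Mathlib

noncomputable section

open MeasureTheory Complex Filter Asymptotics
open scoped SchwartzMap Laplacian ENNReal Topology

namespace NLS

/-- The plane `ℝ²` with its Euclidean norm. -/
abbrev Plane := EuclideanSpace ℝ (Fin 2)

/-- The space `ℂ²` of values (the complexification of `ℝ²`). -/
abbrev Val := EuclideanSpace ℂ (Fin 2)

/-- The Hilbert space `L²(ℝ², ℂ²)`, the complexification of `L²(ℝ², ℝ²)`. -/
abbrev L2 := Lp Val 2 (volume : Measure Plane)

/-! ### Spectra of unbounded operators -/

section Spectrum

variable {H : Type*} [NormedAddCommGroup H] [NormedSpace ℂ H]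

/-- `R` is a bounded two-sided inverse of `z - T : dom T → H`. -/
def IsResolventAt (T : H →ₗ.[ℂ] H) (z : ℂ) (R : H →L[ℂ] H) : Prop :=
  (∀ y : H, ∃ hy : R y ∈ T.domain, z • R y - T ⟨R y, hy⟩ = y) ∧
    ∀ x : T.domain, R (z • (x : H) - T x) = x

/-- The spectrum of an unbounded operator: all `z` for which `z - T : dom T → H` has no
bounded inverse. -/
def spec (T : H →ₗ.[ℂ] H) : Set ℂ :=
  {z | ¬ ∃ R : H →L[ℂ] H, IsResolventAt T z R}

open Classical in
/-- The resolvent `(z - T)⁻¹`; it is given the value `0` for `z` in the spectrum. -/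
def resolventOp (T : H →ₗ.[ℂ] H) (z : ℂ) : H →L[ℂ] H :=
  if h : ∃ R : H →L[ℂ] H, IsResolventAt T z R then h.choose else 0

/-- The Riesz projection `(2πi)⁻¹ ∮ (z - T)⁻¹ dz` over the circle `|z - c| = r`. -/
def rieszProj (T : H →ₗ.[ℂ] H) (c : ℂ) (r : ℝ) : H →L[ℂ] H :=
  (2 * Real.pi * I : ℂ)⁻¹ • ∮ z in C(c, r), resolventOp T z

/-- `z` is an eigenvalue of `T`. -/
def IsEigenvalue (T : H →ₗ.[ℂ] H) (z : ℂ) : Prop :=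
  ∃ x : T.domain, (x : H) ≠ 0 ∧ T x = z • (x : H)

/-- The discrete spectrum: eigenvalues that are isolated points of the spectrum and have finite
(algebraic) multiplicity, that is, a Riesz projection of finite rank. -/
def specDisc (T : H →ₗ.[ℂ] H) : Set ℂ :=
  {z | z ∈ spec T ∧ IsEigenvalue T z ∧
    ∃ r > 0, Metric.closedBall z r ∩ spec T = {z} ∧
      FiniteDimensional ℂ (rieszProj T z r).range}

/-- The essential spectrum: everything in the spectrum outside the discrete spectrum. -/
def specEss (T : H →ₗ.[ℂ] H) : Set ℂ := spec T \ specDisc T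

end Spectrum

/-! ### The Sobolev space `H²` and the Laplacian on it -/

/-- The Sobolev space `H²(ℝ², ℂ²)` as a subspace of `L²(ℝ², ℂ²)`. -/
def H2 : Submodule ℂ L2 where
  carrier := {f | TemperedDistribution.MemSobolev 2 2 (f : 𝓢'(Plane, Val))}
  add_mem' {f g} hf hg := by
    have h := TemperedDistribution.MemSobolev.add hf hg
    rwa [← Lp.toTemperedDistributionCLM_apply, ← Lp.toTemperedDistributionCLM_apply,
      ← map_add] at h
  zero_mem' := by
    have h := TemperedDistribution.memSobolev_fun_zero Plane Val 2 2
    rwa [← map_zero (Lp.toTemperedDistributionCLM Val (volume : Measure Plane) 2)] at h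
  smul_mem' c f hf := by
    have h := TemperedDistribution.MemSobolev.smul c hf
    rwa [← Lp.toTemperedDistributionCLM_apply, ← map_smul] at h

theorem toTempered_injective :
    Function.Injective (Lp.toTemperedDistributionCLM Val (volume : Measure Plane) 2) :=
  LinearMap.ker_eq_bot.mp Lp.ker_toTemperedDistributionCLM_eq_bot

theorem exists_laplacian (f : H2) :
    ∃ h : L2, Δ ((f : L2) : 𝓢'(Plane, Val)) = (h : 𝓢'(Plane, Val)) := by
  have h := TemperedDistribution.MemSobolev.laplacian (f.2 :
    TemperedDistribution.MemSobolev 2 2 ((f : L2) : 𝓢'(Plane, Val)))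
  rw [sub_self] at h
  exact TemperedDistribution.memSobolev_zero_iff.mp h

/-- The Laplacian `Δ : H² → L²`: the function in `L²` that represents the distributional
Laplacian. -/
def lap : H2 →ₗ[ℂ] L2 where
  toFun f := (exists_laplacian f).choose
  map_add' f g := by
    apply toTempered_injective
    rw [map_add]
    simp only [Lp.toTemperedDistributionCLM_apply]
    rw [← (exists_laplacian f).choose_spec, ← (exists_laplacian g).choose_spec,
      ← (exists_laplacian (f + g)).choose_spec]
    simp only [← TemperedDistribution.laplacianCLM_apply, ← Lp.toTemperedDistributionCLM_apply,
      Submodule.coe_add, map_add]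
  map_smul' c f := by
    apply toTempered_injective
    rw [map_smul]
    simp only [Lp.toTemperedDistributionCLM_apply]
    rw [RingHom.id_apply, ← (exists_laplacian f).choose_spec,
      ← (exists_laplacian (c • f)).choose_spec]
    simp only [← TemperedDistribution.laplacianCLM_apply, ← Lp.toTemperedDistributionCLM_apply,
      Submodule.coe_smul, map_smul]

theorem lap_spec (f : H2) :
    Δ ((f : L2) : 𝓢'(Plane, Val)) = (lap f : 𝓢'(Plane, Val)) :=
  (exists_laplacian f).choose_spec

/-! ### The linearization about an exponentially localized spinning wave -/

/-- The matrix `J`. -/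
def J : Matrix (Fin 2) (Fin 2) ℝ := !![0, -1; 1, 0]

/-- The matrix `R`. -/
def R : Matrix (Fin 2) (Fin 2) ℝ := !![1, 0; 0, -1]

/-- A real `2 × 2` matrix acting on `ℂ²`. -/
def act (M : Matrix (Fin 2) (Fin 2) ℝ) : Val →L[ℂ] Val :=
  Matrix.toEuclideanCLM (n := Fin 2) (𝕜 := ℂ) (M.map (fun a : ℝ => (a : ℂ)))

/-- The function `α(s) = (g'(s) + g(s)/s)/2` for `s ≠ 0`, `α(0) = 0`. -/
def alpha (g : ℝ → ℝ) (s : ℝ) : ℝ := if s = 0 then 0 else (deriv g s + g s / s) / 2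

/-- The function `β(s) = (g'(s) - g(s)/s)/2` for `s ≠ 0`, `β(0) = 0`. -/
def beta (g : ℝ → ℝ) (s : ℝ) : ℝ := if s = 0 then 0 else (deriv g s - g s / s) / 2

/-- The data of a standing wave `e^{iωt} e^{imθ} w(r)`, `ω = σ²`, that enter the linearized
operator: the real restriction `g` of the nonlinearity, the degree `m`, the number `σ > 0` and the
exponentially localized radial profile `w` (only its values on `[0, ∞)` matter). -/
structure Wave where
  g : ℝ → ℝ
  m : ℤ
  σ : ℝ
  w : ℝ → ℝ
  contDiff_g : ContDiff ℝ 1 g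
  g_zero : g 0 = 0
  deriv_g : deriv g =O[𝓝 0] fun s => s ^ 2
  σ_pos : 0 < σ
  continuousOn_w : ContinuousOn w (Set.Ici 0)
  decay_w : ∃ C κ : ℝ, 0 < κ ∧ ∀ r, 0 ≤ r → |w r| ≤ C * Real.exp (-κ * r)

/-- The polar angle of a point of the plane. -/
def theta (x : Plane) : ℝ := Complex.arg (x 0 + x 1 * I)

/-- The matrix field `α(w(r)) + β(w(r)) e^{2mθJ} R`. -/
def Wave.matrixField (P : Wave) (x : Plane) : Matrix (Fin 2) (Fin 2) ℝ :=
  alpha P.g (P.w ‖x‖) • (1 : Matrix (Fin 2) (Fin 2) ℝ) +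
    beta P.g (P.w ‖x‖) • (NormedSpace.exp ((2 * (P.m : ℝ) * theta x) • J) * R)

/-! The matrix field is measurable and bounded, so that it acts by multiplication on `L²`. -/

theorem deriv_zero (P : Wave) : deriv P.g 0 = 0 := by
  exact P.deriv_g.eq_zero_imp.self_of_nhds (by simp)

theorem quot_continuous (P : Wave) :
    Continuous (fun s : ℝ => if s = 0 then 0 else P.g s / s) := by
  rw [continuous_iff_continuousAt]
  intro s
  by_cases hs : s = 0
  · subst hs
    have hd : HasDerivAt P.g 0 0 := by
      have := ((P.contDiff_g.differentiable (by norm_num)) 0).hasDerivAt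
      rwa [deriv_zero] at this
    have h := hd.tendsto_slope
    rw [← continuousWithinAt_compl_self]
    unfold ContinuousWithinAt
    simp only [if_true]
    refine h.congr' ?_
    filter_upwards [self_mem_nhdsWithin] with t ht
    have ht' : t ≠ 0 := ht
    simp [ht', slope_def_field, P.g_zero]
  · have h : ContinuousAt (fun s : ℝ => P.g s / s) s :=
      P.contDiff_g.continuous.continuousAt.div continuousAt_id hs
    refine h.congr ?_
    filter_upwards [isOpen_ne.mem_nhds hs] with t ht
    have ht' : t ≠ 0 := ht
    simp [ht']

theorem alpha_continuous (P : Wave) : Continuous (alpha P.g) := by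
  have h : alpha P.g = fun s => (deriv P.g s + (if s = 0 then 0 else P.g s / s)) / 2 := by
    ext s
    by_cases hs : s = 0 <;> simp [alpha, hs, deriv_zero]
  rw [h]
  exact ((P.contDiff_g.continuous_deriv le_rfl).add (quot_continuous P)).div_const 2

theorem beta_continuous (P : Wave) : Continuous (beta P.g) := by
  have h : beta P.g = fun s => (deriv P.g s - (if s = 0 then 0 else P.g s / s)) / 2 := by
    ext s
    by_cases hs : s = 0 <;> simp [beta, hs, deriv_zero]
  rw [h]
  exact ((P.contDiff_g.continuous_deriv le_rfl).sub (quot_continuous P)).div_const 2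

theorem w_norm_continuous (P : Wave) : Continuous (fun x : Plane => P.w ‖x‖) :=
  P.continuousOn_w.comp_continuous continuous_norm (fun x => norm_nonneg x)

theorem w_bounded (P : Wave) : ∃ B : ℝ, ∀ x : Plane, P.w ‖x‖ ∈ Set.Icc (-B) B := by
  obtain ⟨C, κ, hκ, h⟩ := P.decay_w
  refine ⟨|C|, fun x => abs_le.mp ((h ‖x‖ (norm_nonneg x)).trans ?_)⟩
  have h1 : Real.exp (-κ * ‖x‖) ≤ 1 := by
    rw [Real.exp_le_one_iff]
    have := mul_nonneg hκ.le (norm_nonneg x)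
    linarith
  calc C * Real.exp (-κ * ‖x‖) ≤ |C| * Real.exp (-κ * ‖x‖) := by gcongr; exact le_abs_self C
    _ ≤ |C| * 1 := by gcongr
    _ = |C| := mul_one _

theorem comp_w_bounded (P : Wave) {f : ℝ → ℝ} (hf : Continuous f) :
    ∃ B : ℝ, ∀ x : Plane, |f (P.w ‖x‖)| ≤ B := by
  obtain ⟨B, hB⟩ := w_bounded P
  obtain ⟨C, hC⟩ := (isCompact_Icc (a := -B) (b := B)).exists_bound_of_continuousOn hf.continuousOn
  exact ⟨C, fun x => hC _ (hB x)⟩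

theorem rot_continuous (M : Matrix (Fin 2) (Fin 2) ℝ) (i j : Fin 2) :
    Continuous (fun φ : ℝ => (NormedSpace.exp (φ • J) * M) i j) := by
  let _ : NormedRing (Matrix (Fin 2) (Fin 2) ℝ) := Matrix.linftyOpNormedRing
  let _ : NormedAlgebra ℝ (Matrix (Fin 2) (Fin 2) ℝ) := Matrix.linftyOpNormedAlgebra
  let _ : NormedAlgebra ℚ (Matrix (Fin 2) (Fin 2) ℝ) := NormedAlgebra.restrictScalars ℚ ℝ _
  have h1 : Continuous (fun φ : ℝ => NormedSpace.exp (φ • J)) :=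
    NormedSpace.exp_continuous.comp (continuous_id.smul continuous_const)
  exact (h1.matrix_mul continuous_const).matrix_elem i j

theorem theta_measurable : Measurable theta := by
  unfold theta
  fun_prop

theorem theta_mem (x : Plane) : theta x ∈ Set.Icc (-Real.pi) Real.pi :=
  ⟨(Complex.neg_pi_lt_arg _).le, Complex.arg_le_pi _⟩

theorem matrixField_apply (P : Wave) (x : Plane) (i j : Fin 2) :
    P.matrixField x i j = alpha P.g (P.w ‖x‖) * (1 : Matrix (Fin 2) (Fin 2) ℝ) i j +
      beta P.g (P.w ‖x‖) * (NormedSpace.exp ((2 * (P.m : ℝ) * theta x) • J) * R) i j := by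
  simp only [Wave.matrixField, Matrix.add_apply, Matrix.smul_apply, smul_eq_mul]

theorem matrixField_measurable (P : Wave) (i j : Fin 2) :
    Measurable (fun x => P.matrixField x i j) := by
  simp only [matrixField_apply]
  have h1 := ((alpha_continuous P).comp (w_norm_continuous P)).measurable
  have h2 := ((beta_continuous P).comp (w_norm_continuous P)).measurable
  have h3 := (rot_continuous R i j).measurable.comp (theta_measurable.const_mul (2 * (P.m : ℝ)))
  exact (h1.mul_const _).add (h2.mul h3)

theorem matrixField_bounded (P : Wave) :
    ∃ B : ℝ, ∀ x i j, |P.matrixField x i j| ≤ B := by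
  obtain ⟨B1, h1⟩ := comp_w_bounded P (alpha_continuous P)
  obtain ⟨B2, h2⟩ := comp_w_bounded P (beta_continuous P)
  have h3 : ∀ i j, ∃ B : ℝ, ∀ x : Plane,
      |(NormedSpace.exp ((2 * (P.m : ℝ) * theta x) • J) * R) i j| ≤ B := by
    intro i j
    obtain ⟨C, hC⟩ := (isCompact_Icc (a := -Real.pi) (b := Real.pi)).exists_bound_of_continuousOn
      ((rot_continuous R i j).comp (continuous_const_mul (2 * (P.m : ℝ)))).continuousOn
    exact ⟨C, fun x => hC _ (theta_mem x)⟩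
  choose B3 h3 using h3
  have h4 : ∀ i j, ∃ B : ℝ, ∀ x, |P.matrixField x i j| ≤ B := by
    intro i j
    refine ⟨B1 * |(1 : Matrix (Fin 2) (Fin 2) ℝ) i j| + B2 * B3 i j, fun x => ?_⟩
    rw [matrixField_apply]
    refine (abs_add_le _ _).trans ?_
    rw [abs_mul, abs_mul]
    have := (abs_nonneg _).trans (h2 x)
    gcongr
    · exact h1 x
    · exact h2 x
    · exact h3 i j x
  choose B4 h4 using h4
  refine ⟨∑ i, ∑ j, |B4 i j|, fun x i j => ?_⟩
  calc |P.matrixField x i j| ≤ |B4 i j| := (h4 i j x).trans (le_abs_self _)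
    _ ≤ ∑ j, |B4 i j| := Finset.single_le_sum (f := fun j => |B4 i j|)
        (fun _ _ => abs_nonneg _) (Finset.mem_univ j)
    _ ≤ _ := Finset.single_le_sum (f := fun i => ∑ j, |B4 i j|)
        (fun _ _ => Finset.sum_nonneg fun _ _ => abs_nonneg _) (Finset.mem_univ i)

theorem act_apply (M : Matrix (Fin 2) (Fin 2) ℝ) (v : Val) (i : Fin 2) :
    act M v i = (M i 0 : ℂ) * v 0 + (M i 1 : ℂ) * v 1 := by
  simp [act, Matrix.mulVec, dotProduct]

theorem matrixField_memLp (P : Wave) (f : L2) :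
    MemLp (fun x => act (P.matrixField x) (f x)) 2 (volume : Measure Plane) := by
  obtain ⟨B, hB⟩ := matrixField_bounded P
  have hf : ∀ i, MemLp (fun x => f x i) 2 (volume : Measure Plane) := fun i =>
    (EuclideanSpace.proj (𝕜 := ℂ) i).comp_memLp' (Lp.memLp f)
  have hp : ∀ i j, MemLp (fun x => (P.matrixField x i j : ℂ) * f x j) 2
      (volume : Measure Plane) := by
    intro i j
    refine (hf j).of_le_mul (c := B) ?_ (ae_of_all _ fun x => ?_)
    · exact ((Complex.measurable_ofReal.comp
        (matrixField_measurable P i j)).aestronglyMeasurable).mul (hf j).1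
    · rw [norm_mul, Complex.norm_real, Real.norm_eq_abs]
      gcongr
      exact hB x i j
  rw [memLp_piLp_iff]
  intro i
  simp only [act_apply]
  exact (hp i 0).add (hp i 1)

/-- Multiplication by `α(w(r)) + β(w(r)) e^{2mθJ} R` on `L²`. -/
def Wave.potential (P : Wave) : L2 →ₗ[ℂ] L2 where
  toFun f := (matrixField_memLp P f).toLp _
  map_add' f g := by
    rw [← MemLp.toLp_add]
    apply MemLp.toLp_congr
    filter_upwards [Lp.coeFn_add f g] with x hx
    rw [hx, Pi.add_apply, Pi.add_apply, map_add]
  map_smul' c f := by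
    rw [RingHom.id_apply, ← MemLp.toLp_const_smul]
    apply MemLp.toLp_congr
    filter_upwards [Lp.coeFn_smul c f] with x hx
    rw [hx, Pi.smul_apply, Pi.smul_apply, map_smul]

theorem potential_coeFn (P : Wave) (f : L2) :
    P.potential f =ᵐ[volume] fun x => act (P.matrixField x) (f x) :=
  (matrixField_memLp P f).coeFn_toLp

/-- The matrix `J` acting on `L²`. -/
def JL2 : L2 →L[ℂ] L2 := (act J).compLpL 2 (volume : Measure Plane)

/-- The operator `A₀ = J (Δ - σ²)` on `L²(ℝ², ℂ²)` with domain `H²`. -/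
def opA0 (σ : ℝ) : L2 →ₗ.[ℂ] L2 where
  domain := H2
  toFun := JL2.toLinearMap ∘ₗ (lap - ((σ : ℂ) ^ 2) • H2.subtype)

/-- The linearized operator `A = J (Δ - σ² + α(w(r)) + β(w(r)) e^{2mθJ} R)` on `L²(ℝ², ℂ²)` with
domain `H²`. -/
def Wave.opA (P : Wave) : L2 →ₗ.[ℂ] L2 where
  domain := H2
  toFun := JL2.toLinearMap ∘ₗ
    (lap - ((P.σ : ℂ) ^ 2) • H2.subtype + P.potential ∘ₗ H2.subtype)

end NLS

end

noncomputable section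

open MeasureTheory Complex Filter Asymptotics
open scoped SchwartzMap Laplacian ENNReal Topology FourierTransform BoundedContinuousFunction

namespace NLS

/-! ### Resolvents of unbounded operators. -/

section Resolvent

variable {H : Type*} [NormedAddCommGroup H] [NormedSpace ℂ H]

/-! Write `A = A₀ + B`, where `B = J V` is bounded and the matrix potential `V` tends to zero at
infinity. On the Fourier side `A₀` is multiplication by `-(σ² + 4π²|ξ|²) J`, whose eigenvalues are
`±i(σ² + 4π²|ξ|²)`. Hence `spec A₀` consists of the two half-lines (`spec_opA0`), and `A₀` has no
eigenvalues because each value is taken only on a circle, a null set (`not_isEigenvalue_opA0`).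

`B` is compact relative to `A₀`: `V` is a norm limit of its cutoffs to balls, and a compactly
supported function times the Bessel potential is an operator with square integrable kernel
(`isCompactOperator_potentialL_bessel`).

Off the half-lines, `z - A = (1 - B (z - A₀)⁻¹)(z - A₀)`. The complement of the half-lines is
connected and the first factor is invertible for large real `z`, so the analytic Fredholm theorem
makes the remaining spectrum isolated. The Riesz projections there are compact idempotents, hence of
finite rank (`mem_specDisc_of_notMem_spec`).

On the half-lines the roles are exchanged: if `z - A` were invertible, the Fredholm alternative for
`A₀ = A - B` would make `z` an eigenvalue of `A₀` (`isEigenvalue_of_notMem_spec`), which is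
impossible. So the half-lines lie in `spec A`, and since they have no isolated points, none of their
points is discrete. -/

theorem IsResolventAt.unique {T : H →ₗ.[ℂ] H} {z : ℂ} {R R' : H →L[ℂ] H}
    (h : IsResolventAt T z R) (h' : IsResolventAt T z R') : R = R' := by
  ext y
  obtain ⟨hy, e⟩ := h'.1 y
  conv_lhs => rw [← e]
  exact h.2 ⟨R' y, hy⟩

theorem isResolventAt_resolventOp {T : H →ₗ.[ℂ] H} {z : ℂ} (hz : z ∉ spec T) :
    IsResolventAt T z (resolventOp T z) := by
  have h : ∃ R : H →L[ℂ] H, IsResolventAt T z R := not_not.mp hz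
  rw [resolventOp, dif_pos h]
  exact h.choose_spec

theorem IsResolventAt.notMem_spec {T : H →ₗ.[ℂ] H} {z : ℂ} {R : H →L[ℂ] H}
    (h : IsResolventAt T z R) : z ∉ spec T := fun hz => hz ⟨R, h⟩

theorem IsResolventAt.resolventOp_eq {T : H →ₗ.[ℂ] H} {z : ℂ} {R : H →L[ℂ] H}
    (h : IsResolventAt T z R) : resolventOp T z = R :=
  (isResolventAt_resolventOp h.notMem_spec).unique h

/-- If `z' - T' = S (z - T)` with an invertible `S`, then the resolvent of `T` at `z` gives the
resolvent of `T'` at `z'`. -/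
theorem IsResolventAt.of_unit_mul {T T' : H →ₗ.[ℂ] H} {z z' : ℂ} {R : H →L[ℂ] H}
    (h : IsResolventAt T z R) (hd : T'.domain = T.domain) (S : (H →L[ℂ] H)ˣ)
    (hS : ∀ (x : H) (hx : x ∈ T.domain) (hx' : x ∈ T'.domain),
      z' • x - T' ⟨x, hx'⟩ = (S : H →L[ℂ] H) (z • x - T ⟨x, hx⟩)) :
    IsResolventAt T' z' (R ∘L (↑S⁻¹ : H →L[ℂ] H)) := by
  have h1 : ∀ y, (S : H →L[ℂ] H) ((↑S⁻¹ : H →L[ℂ] H) y) = y := fun y => by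
    rw [← mul_apply_eq_comp, Units.mul_inv, one_apply_eq_self]
  have h2 : ∀ y, (↑S⁻¹ : H →L[ℂ] H) ((S : H →L[ℂ] H) y) = y := fun y => by
    rw [← mul_apply_eq_comp, Units.inv_mul, one_apply_eq_self]
  constructor
  · intro y
    obtain ⟨hy, e⟩ := h.1 ((↑S⁻¹ : H →L[ℂ] H) y)
    refine ⟨hd ▸ hy, ?_⟩
    have := hS _ hy (hd ▸ hy)
    rw [e, h1] at this
    exact this
  · rintro ⟨x, hx'⟩
    have hx : x ∈ T.domain := hd ▸ hx'
    rw [hS x hx hx', ContinuousLinearMap.comp_apply, h2]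
    exact h.2 ⟨x, hx⟩

/-- If `z' - T' = S (z - T)` and both resolvents exist, then `S` is invertible. -/
theorem IsResolventAt.isUnit [CompleteSpace H] {T T' : H →ₗ.[ℂ] H} {z z' : ℂ} {R R' : H →L[ℂ] H}
    (h : IsResolventAt T z R) (h' : IsResolventAt T' z' R') (hd : T'.domain = T.domain)
    (S : H →L[ℂ] H)
    (hS : ∀ (x : H) (hx : x ∈ T.domain) (hx' : x ∈ T'.domain),
      z' • x - T' ⟨x, hx'⟩ = S (z • x - T ⟨x, hx⟩)) : IsUnit S := by
  rw [ContinuousLinearMap.isUnit_iff_bijective]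
  constructor
  · rw [injective_iff_map_eq_zero]
    intro y hy
    obtain ⟨hR, e⟩ := h.1 y
    have h1 := hS _ hR (hd ▸ hR)
    rw [e, hy] at h1
    have h2 := h'.2 ⟨R y, hd ▸ hR⟩
    rw [h1, map_zero] at h2
    have h3 : (⟨R y, hR⟩ : T.domain) = 0 := Subtype.ext h2.symm
    have h4 : R y = 0 := h2.symm
    rw [← e, h3, LinearPMap.map_zero, sub_zero, h4, smul_zero]
  · intro y
    obtain ⟨hR, e⟩ := h'.1 y
    exact ⟨_, ((hS _ (hd ▸ hR) hR).symm.trans e)⟩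

/-- The first resolvent identity, the source of the derivative of the resolvent and of the
idempotence of Riesz projections. -/
theorem IsResolventAt.sub_eq {T : H →ₗ.[ℂ] H} {z w : ℂ} {R R' : H →L[ℂ] H}
    (h : IsResolventAt T z R) (h' : IsResolventAt T w R') :
    R - R' = (w - z) • (R ∘L R') := by
  ext y
  obtain ⟨hy, e⟩ := h'.1 y
  have h1 := h.2 ⟨R' y, hy⟩
  have h2 : z • R' y - T ⟨R' y, hy⟩ = y - (w - z) • R' y := by
    linear_combination (norm := module) e
  simp only at h1
  rw [h2, map_sub, map_smul] at h1
  simp only [sub_apply, smul_apply,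
    ContinuousLinearMap.comp_apply]
  linear_combination (norm := module) h1

variable [CompleteSpace H]

/-- `z - T = (1 + (z - w) R)(w - T)` with `R = (w - T)⁻¹`, and the first factor is invertible for
`z` near `w`. -/
theorem isOpen_compl_spec (T : H →ₗ.[ℂ] H) : IsOpen (spec T)ᶜ := by
  rw [isOpen_iff_mem_nhds]
  intro w hw
  set R := resolventOp T w
  have hR : IsResolventAt T w R := isResolventAt_resolventOp hw
  have hc : ContinuousAt (fun z : ℂ => (1 : H →L[ℂ] H) + (z - w) • R) w := by fun_prop
  have hu : IsUnit ((1 : H →L[ℂ] H) + (w - w) • R) := by simp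
  filter_upwards [hc.eventually (Units.isOpen.mem_nhds hu)] with z hz
  obtain ⟨S, hS⟩ := hz
  refine (hR.of_unit_mul (z' := z) rfl S fun x hx hx' => ?_).notMem_spec
  rw [hS]
  simp only [add_apply, one_apply_eq_self,
    smul_apply]
  rw [hR.2 ⟨x, hx⟩]
  module

theorem continuousAt_resolventOp {T : H →ₗ.[ℂ] H} {w : ℂ} (hw : w ∉ spec T) :
    ContinuousAt (resolventOp T) w := by
  set R := resolventOp T w with hRdef
  have hR : IsResolventAt T w R := isResolventAt_resolventOp hw
  have hc : ContinuousAt (fun z : ℂ => (1 : H →L[ℂ] H) + (z - w) • R) w := by fun_prop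
  have hu : IsUnit ((1 : H →L[ℂ] H) + (w - w) • R) := by simp
  have hev : ∀ᶠ z in 𝓝 w, resolventOp T z =
      R ∘L Ring.inverse ((1 : H →L[ℂ] H) + (z - w) • R) := by
    filter_upwards [hc.eventually (Units.isOpen.mem_nhds hu)] with z hz
    obtain ⟨S, hS⟩ := hz
    refine (IsResolventAt.resolventOp_eq ?_).trans (by rw [← hS, Ring.inverse_unit])
    refine (hR.of_unit_mul (z' := z) rfl S fun x hx hx' => ?_)
    rw [hS]
    simp only [add_apply, one_apply_eq_self,
      smul_apply]
    rw [hR.2 ⟨x, hx⟩]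
    module
  refine ContinuousAt.congr ?_ (hev.mono fun _ h => h.symm)
  have h1 : ContinuousAt (fun z : ℂ => Ring.inverse ((1 : H →L[ℂ] H) + (z - w) • R)) w := by
    obtain ⟨S, hS⟩ := hu
    have h2 : ContinuousAt Ring.inverse ((1 : H →L[ℂ] H) + (w - w) • R) :=
      hS ▸ NormedRing.inverse_continuousAt S
    exact ContinuousAt.comp (f := fun z : ℂ => (1 : H →L[ℂ] H) + (z - w) • R) h2 hc
  exact continuousAt_const.clm_comp h1

theorem hasDerivAt_resolventOp {T : H →ₗ.[ℂ] H} {w : ℂ} (hw : w ∉ spec T) :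
    HasDerivAt (resolventOp T) (-(resolventOp T w ∘L resolventOp T w)) w := by
  rw [hasDerivAt_iff_tendsto_slope]
  have h : Tendsto (fun z => -(resolventOp T z ∘L resolventOp T w)) (𝓝[≠] w)
      (𝓝 (-(resolventOp T w ∘L resolventOp T w))) :=
    (((continuousAt_resolventOp hw).clm_comp continuousAt_const).neg).tendsto.mono_left
      nhdsWithin_le_nhds
  refine h.congr' ?_
  filter_upwards [self_mem_nhdsWithin,
    nhdsWithin_le_nhds ((isOpen_compl_spec T).mem_nhds hw)] with z hz hz'
  have hne : z - w ≠ 0 := sub_ne_zero.mpr hz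
  rw [slope_def_module, (isResolventAt_resolventOp hz').sub_eq (isResolventAt_resolventOp hw),
    smul_smul, ← neg_sub z w, mul_neg, inv_mul_cancel₀ hne, neg_one_smul]

theorem differentiableOn_resolventOp (T : H →ₗ.[ℂ] H) :
    DifferentiableOn ℂ (resolventOp T) (spec T)ᶜ := fun _ hw =>
  (hasDerivAt_resolventOp hw).differentiableAt.differentiableWithinAt

end Resolvent

/-! ### The analytic Fredholm theorem. -/

section AnalyticFredholm

variable {H : Type*} [NormedAddCommGroup H] [InnerProductSpace ℂ H]

/-- Take for `W` the span of a finite `ε`-net of the image of the unit ball: the projection onto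
`Wᗮ` kills the net and does not increase distances. -/
theorem exists_finiteDimensional_approx {K : H →L[ℂ] H} (hK : IsCompactOperator K) {ε : ℝ}
    (hε : 0 < ε) : ∃ W : Submodule ℂ H, ∃ _ : FiniteDimensional ℂ W,
      ‖K - W.starProjection ∘L K‖ ≤ ε := by
  have hc := hK.isCompact_closure_image_closedBall (f := (K : H →ₗ[ℂ] H)) 1
  obtain ⟨t, ht, hcov⟩ := Metric.totallyBounded_iff.mp hc.totallyBounded ε hε
  have : Finite t := ht
  have hfd : FiniteDimensional ℂ (Submodule.span ℂ t) := FiniteDimensional.span_of_finite ℂ ht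
  refine ⟨Submodule.span ℂ t, hfd, ?_⟩
  set W := Submodule.span ℂ t
  refine ContinuousLinearMap.opNorm_le_of_unit_norm (𝕜 := ℂ) hε.le fun x hx => ?_
  have hKx : K x ∈ closure ((K : H →ₗ[ℂ] H) '' Metric.closedBall 0 1) :=
    subset_closure ⟨x, by simp [hx], rfl⟩
  obtain ⟨y, hy, hxy⟩ := Set.mem_iUnion₂.mp (hcov hKx)
  have hyW : W.starProjection y = y :=
    Submodule.starProjection_eq_self_iff.mpr (Submodule.subset_span hy)
  have e : (K - W.starProjection ∘L K) x = Wᗮ.starProjection (K x - y) := by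
    rw [Submodule.starProjection_orthogonal]
    simp [hyW]
  rw [e]
  refine (Submodule.norm_starProjection_apply_le _ _).trans ?_
  rw [← dist_eq_norm]
  exact (Metric.mem_ball.mp hxy).le

/-- The compression of `1 - X` to a finite-dimensional subspace `W`. -/
def compression (W : Submodule ℂ H) [FiniteDimensional ℂ W] (X : H →L[ℂ] H) : W →ₗ[ℂ] W :=
  LinearMap.id - (W.orthogonalProjectionOnto ∘L X).toLinearMap ∘ₗ W.subtype

/-- The operator is the identity modulo `W`: its kernel lies in `W`, and a preimage of `y` can be
sought in `y + W`. Invertibility is therefore decided by a finite determinant. -/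
theorem isUnit_one_sub_starProjection_comp_iff [CompleteSpace H] (W : Submodule ℂ H)
    [FiniteDimensional ℂ W] (X : H →L[ℂ] H) :
    IsUnit (1 - W.starProjection ∘L X) ↔ LinearMap.det (compression W X) ≠ 0 := by
  have hM : ∀ w : W, ((compression W X w : W) : H) = (1 - W.starProjection ∘L X) (w : H) := by
    intro w
    simp [compression]
  have hM' : ∀ x, (1 - W.starProjection ∘L X) x = x - W.orthogonalProjectionOnto (X x) := by
    intro x
    simp
  constructor
  · intro h
    rw [ContinuousLinearMap.isUnit_iff_bijective] at h
    have hinj : Function.Injective (compression W X) := by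
      intro v w hvw
      apply Subtype.ext
      apply h.1
      rw [← hM, ← hM, hvw]
    exact (LinearEquiv.ofInjectiveEndo _ hinj).isUnit_det'.ne_zero
  · intro h
    have hu : IsUnit (compression W X) := (LinearMap.isUnit_iff_isUnit_det _).mpr h.isUnit
    have hb := (Module.End.isUnit_iff _).mp hu
    rw [ContinuousLinearMap.isUnit_iff_bijective]
    constructor
    · rw [injective_iff_map_eq_zero]
      intro x hx
      have hx1 := hx
      rw [hM', sub_eq_zero] at hx1
      have h0 : compression W X ⟨x, hx1 ▸ Subtype.coe_prop _⟩ = 0 := by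
        apply Subtype.ext
        rw [hM]
        exact hx
      have := hb.1 (h0.trans (map_zero _).symm)
      exact congrArg Subtype.val this
    · intro y
      obtain ⟨w, hw⟩ := hb.2 (W.orthogonalProjectionOnto (X y))
      refine ⟨y + w, ?_⟩
      rw [map_add, ← hM, hw, hM']
      simp

theorem analyticAt_det_compression (W : Submodule ℂ H) [FiniteDimensional ℂ W]
    {X : ℂ → H →L[ℂ] H} {z₀ : ℂ} (hX : AnalyticAt ℂ X z₀) :
    AnalyticAt ℂ (fun z => LinearMap.det (compression W (X z))) z₀ := by
  let b := Module.finBasis ℂ W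
  have he : ∀ i j, AnalyticAt ℂ (fun z => LinearMap.toMatrix b b (compression W (X z)) i j) z₀ := by
    intro i j
    let L : (H →L[ℂ] H) →L[ℂ] ℂ :=
      (LinearMap.toContinuousLinearMap (b.coord i)) ∘L W.orthogonalProjectionOnto ∘L
        (ContinuousLinearMap.apply ℂ H (b j : H))
    have h1 : (fun z => LinearMap.toMatrix b b (compression W (X z)) i j) =
        fun z => b.coord i (b j) - L (X z) := by
      ext z
      simp [LinearMap.toMatrix_apply, compression, L]
    rw [h1]
    exact analyticAt_const.sub (L.analyticAt _ |>.comp hX)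
  have h2 : (fun z => LinearMap.det (compression W (X z))) =
      fun z => ∑ σ : Equiv.Perm (Fin (Module.finrank ℂ W)), Equiv.Perm.sign σ •
        ∏ i, LinearMap.toMatrix b b (compression W (X z)) (σ i) i := by
    ext z
    rw [← LinearMap.det_toMatrix b, Matrix.det_apply]
  rw [h2]
  refine Finset.analyticAt_fun_sum _ fun σ _ => ?_
  simp only [Units.smul_def, ← Int.cast_smul_eq_zsmul ℂ, smul_eq_mul]
  exact analyticAt_const.mul (Finset.analyticAt_fun_prod _ fun i _ => he _ _)

variable [CompleteSpace H]

/-- With `P` the projection onto `W` and `B = 1 - (K - P K)`, one has `1 - K = (1 - P K B⁻¹) B`, and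
`B` is invertible near `z₀`. Invertibility of `1 - K` thus means that a scalar analytic determinant
is nonzero, and zeros of such a function are isolated unless it vanishes identically nearby. -/
theorem eventually_not_isUnit_or_eventually_isUnit {K : ℂ → H →L[ℂ] H} {z₀ : ℂ}
    (hK : AnalyticAt ℂ K z₀) (hc : IsCompactOperator (K z₀)) :
    (∀ᶠ z in 𝓝 z₀, ¬ IsUnit (1 - K z)) ∨ ∀ᶠ z in 𝓝[≠] z₀, IsUnit (1 - K z) := by
  obtain ⟨W, hW, hn⟩ := exists_finiteDimensional_approx hc (ε := 1 / 2) (by norm_num)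
  let B : ℂ → H →L[ℂ] H := fun z => 1 - (K z - W.starProjection ∘L K z)
  have hPK : AnalyticAt ℂ (fun z => W.starProjection ∘L K z) z₀ :=
    ((ContinuousLinearMap.compL ℂ H H H W.starProjection).analyticAt _).comp hK
  have hB : AnalyticAt ℂ B z₀ := analyticAt_const.sub (hK.sub hPK)
  have hB0 : IsUnit (B z₀) := (Units.oneSub _ (hn.trans_lt (by norm_num))).isUnit
  have hBu : ∀ᶠ z in 𝓝 z₀, IsUnit (B z) :=
    hB.continuousAt.eventually (Units.isOpen.mem_nhds hB0)
  have hinv : AnalyticAt ℂ (fun z => Ring.inverse (B z)) z₀ := by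
    obtain ⟨u, hu⟩ := hB0
    have : AnalyticAt ℂ Ring.inverse (B z₀) := hu ▸ analyticAt_inverse u
    exact AnalyticAt.fun_comp this hB
  let X : ℂ → H →L[ℂ] H := fun z => K z * Ring.inverse (B z)
  have hX : AnalyticAt ℂ X z₀ := hK.mul hinv
  have key : ∀ᶠ z in 𝓝 z₀,
      (IsUnit (1 - K z) ↔ LinearMap.det (compression W (X z)) ≠ 0) := by
    filter_upwards [hBu] with z hz
    rw [← isUnit_one_sub_starProjection_comp_iff]
    have e : (1 - W.starProjection ∘L X z) * B z = 1 - K z := by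
      have h1 : Ring.inverse (B z) * B z = 1 := Ring.inverse_mul_cancel _ hz
      have h2 : (W.starProjection ∘L X z) = W.starProjection * K z * Ring.inverse (B z) := by
        rw [mul_assoc]; rfl
      have h3 : B z = 1 - (K z - W.starProjection * K z) := rfl
      rw [sub_mul, h2, mul_assoc, h1, h3]
      simp only [one_mul, mul_one]
      abel
    rw [← e]
    exact hz.mul_right_iff
  rcases (analyticAt_det_compression W hX).eventually_eq_zero_or_eventually_ne_zero with h | h
  · left
    filter_upwards [key, h] with z hz h0
    rw [hz]
    simpa using h0
  · right
    filter_upwards [nhdsWithin_le_nhds key, h] with z hz h0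
    exact hz.mpr h0

/-- The analytic Fredholm theorem: the points where `1 - K z` is not invertible are isolated. -/
theorem analytic_fredholm {K : ℂ → H →L[ℂ] H} {U : Set ℂ} (hU : IsOpen U)
    (hUc : IsPreconnected U) (hK : DifferentiableOn ℂ K U)
    (hc : ∀ z ∈ U, IsCompactOperator (K z)) {w : ℂ} (hw : w ∈ U) (hwu : IsUnit (1 - K w))
    {z : ℂ} (hz : z ∈ U) : ∀ᶠ z' in 𝓝[≠] z, IsUnit (1 - K z') := by
  have hd : ∀ z ∈ U, (∀ᶠ z' in 𝓝 z, ¬ IsUnit (1 - K z')) ∨ ∀ᶠ z' in 𝓝[≠] z, IsUnit (1 - K z') :=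
    fun z hz => eventually_not_isUnit_or_eventually_isUnit
      (hK.analyticAt (hU.mem_nhds hz)) (hc z hz)
  -- `A` and `B` are open, disjoint and cover the preconnected set `U`; the point `w` lies in `B`,
  -- so `A` misses `U`.
  let A : Set ℂ := {z | ∀ᶠ z' in 𝓝 z, ¬ IsUnit (1 - K z')}
  let B : Set ℂ := {z | ∀ᶠ z' in 𝓝[≠] z, IsUnit (1 - K z')}
  have hA : IsOpen A := isOpen_setOfPred_eventually_nhds
  have hB : IsOpen B := isOpen_setOfPred_eventually_nhdsWithin
  have hAB : ∀ z, z ∈ A → z ∉ B := by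
    intro z hzA hzB
    have hzA' : ∀ᶠ z' in 𝓝[≠] z, ¬ IsUnit (1 - K z') :=
      Filter.Eventually.filter_mono nhdsWithin_le_nhds hzA
    obtain ⟨z', h1, h2⟩ := (hzA'.and hzB).exists
    exact h1 h2
  by_contra hzB
  have hzA : z ∈ A := (hd z hz).resolve_right hzB
  have hwB : w ∈ B := (hd w hw).resolve_left fun h => h.self_of_nhds hwu
  obtain ⟨v, -, hvA, hvB⟩ := hUc A B hA hB (fun z hz => hd z hz) ⟨z, hz, hzA⟩ ⟨w, hw, hwB⟩
  exact hAB v hvA hvB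

end AnalyticFredholm

/-- The Fredholm alternative at the spectral value `1`. -/
theorem exists_fixed_of_not_isUnit {X : Type*} [NormedAddCommGroup X] [NormedSpace ℂ X]
    [CompleteSpace X] {K : X →L[ℂ] X} (hK : IsCompactOperator K) (h : ¬ IsUnit (1 - K)) :
    ∃ x, x ≠ 0 ∧ K x = x := by
  rcases hK.hasEigenvalue_or_mem_resolventSet one_ne_zero with h1 | h1
  · obtain ⟨x, hx⟩ := h1.exists_hasEigenvector
    exact ⟨x, hx.2, by simpa using hx.apply_eq_smul⟩
  · rw [spectrum.mem_resolventSet_iff, map_one] at h1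
    exact absurd h1 h

/-! ### Circle integrals of vector-valued functions. -/

section CircleIntegral

variable {E F : Type*} [NormedAddCommGroup E] [NormedSpace ℂ E] [CompleteSpace E]
  [NormedAddCommGroup F] [NormedSpace ℂ F] [CompleteSpace F]

theorem circleIntegral_clm_comp (L : E →L[ℂ] F) {f : ℂ → E} {c : ℂ} {r : ℝ}
    (hf : CircleIntegrable f c r) : (∮ z in C(c, r), L (f z)) = L (∮ z in C(c, r), f z) := by
  simp only [circleIntegral, ← map_smul]
  exact L.intervalIntegral_comp_comm hf.out

/-- In the quotient `E ⧸ S` the integrand vanishes. This is applied to the closed subspace of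
compact operators. -/
theorem circleIntegral_mem {S : Submodule ℂ E} (hS : IsClosed (S : Set E)) {f : ℂ → E} {c : ℂ}
    {r : ℝ} (hr : 0 ≤ r) (hf : CircleIntegrable f c r)
    (hfS : ∀ z ∈ Metric.sphere c r, f z ∈ S) : (∮ z in C(c, r), f z) ∈ S := by
  have : IsClosed (S : Set E) := hS
  have h := circleIntegral_clm_comp S.mkQL hf
  have h0 : (∮ z in C(c, r), S.mkQL (f z)) = ∮ _ in C(c, r), (0 : E ⧸ S) :=
    circleIntegral.integral_congr hr
      fun z hz => (Submodule.Quotient.mk_eq_zero S).mpr (hfS z hz)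
  rw [h0, show (∮ _ in C(c, r), (0 : E ⧸ S)) = 0 by simp [circleIntegral]] at h
  exact (Submodule.Quotient.mk_eq_zero S).mp h.symm

end CircleIntegral

/-! ### Riesz projections. -/

section Riesz

variable {H : Type*} [NormedAddCommGroup H] [NormedSpace ℂ H] [CompleteSpace H]

theorem continuousOn_sphere_resolventOp {T : H →ₗ.[ℂ] H} {c : ℂ} {ρ r : ℝ} (hr : 0 < r) (hrρ : r ≤ ρ)
    (hT : ∀ z ∈ Metric.closedBall c ρ, z ≠ c → z ∉ spec T) :
    ContinuousOn (resolventOp T) (Metric.sphere c r) := fun z hz =>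
  (continuousAt_resolventOp (hT z (Metric.sphere_subset_closedBall.trans
    (Metric.closedBall_subset_closedBall hrρ) hz)
    (Metric.ne_of_mem_sphere hz hr.ne'))).continuousWithinAt

theorem circleIntegral_resolventOp_eq {T : H →ₗ.[ℂ] H} {c : ℂ} {ρ r : ℝ} (hr : 0 < r)
    (hrρ : r ≤ ρ) (hT : ∀ z ∈ Metric.closedBall c ρ, z ≠ c → z ∉ spec T) :
    (∮ z in C(c, ρ), resolventOp T z) = ∮ z in C(c, r), resolventOp T z := by
  have hne : ∀ z, z ∉ Metric.ball c r → z ≠ c := by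
    rintro z hz rfl
    exact hz (Metric.mem_ball_self hr)
  refine circleIntegral_eq_of_differentiable_on_annulus_off_countable hr hrρ
    Set.countable_empty (fun z hz => ?_) (fun z hz => ?_)
  · exact (continuousAt_resolventOp (hT z hz.1 (hne z hz.2))).continuousWithinAt
  · refine (hasDerivAt_resolventOp (hT z (Metric.ball_subset_closedBall hz.1.1)
      (hne z fun h => hz.1.2 (Metric.ball_subset_closedBall h)))).differentiableAt

/-- Different radii keep `w - z` away from zero, so that `R(z) R(w) = (R(z) - R(w)) / (w - z)`.
Integrated over the outer circle, the first term gives `2πi R(z)` by Cauchy's formula. The second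
gives a function holomorphic inside that circle, whose integral over the inner circle is zero. -/
theorem circleIntegral_resolventOp_mul {T : H →ₗ.[ℂ] H} {c : ℂ} {ρ r : ℝ} (hr : 0 < r)
    (hrρ : r < ρ) (hT : ∀ z ∈ Metric.closedBall c ρ, z ≠ c → z ∉ spec T) :
    (∮ z in C(c, r), resolventOp T z) * (∮ z in C(c, ρ), resolventOp T z) =
      (2 * Real.pi * I : ℂ) • ∮ z in C(c, r), resolventOp T z := by
  have hρ : 0 < ρ := hr.trans hrρ
  have hcr := continuousOn_sphere_resolventOp hr hrρ.le hT
  have hcρ := continuousOn_sphere_resolventOp hρ le_rfl hT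
  have hir : CircleIntegrable (resolventOp T) c r := hcr.circleIntegrable hr.le
  have hiρ : CircleIntegrable (resolventOp T) c ρ := hcρ.circleIntegrable hρ.le
  have hpi : (2 * Real.pi * I : ℂ) ≠ 0 := Complex.two_pi_I_ne_zero
  set Q := ∮ z in C(c, ρ), resolventOp T z with hQ
  let F : ℂ → H →L[ℂ] H := fun z =>
    (2 * Real.pi * I : ℂ)⁻¹ • ∮ w in C(c, ρ), (w - z)⁻¹ • resolventOp T w
  have hF : DifferentiableOn ℂ F (Metric.ball c ρ) := by
    lift ρ to NNReal using hρ.le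
    have h := (hasFPowerSeriesOn_cauchy_integral hiρ hρ).differentiableOn
    rwa [Metric.eball_coe] at h
  have hF0 : (∮ z in C(c, r), F z) = 0 := by
    refine circleIntegral_eq_zero_of_differentiable_on_off_countable hr.le Set.countable_empty
      (hF.continuousOn.mono (Metric.closedBall_subset_ball hrρ)) (fun z hz => ?_)
    exact hF.differentiableAt (Metric.isOpen_ball.mem_nhds (Metric.ball_subset_ball hrρ.le hz.1))
  have hFc : ContinuousOn F (Metric.sphere c r) :=
    hF.continuousOn.mono (Metric.sphere_subset_closedBall.trans (Metric.closedBall_subset_ball hrρ))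
  have key : ∀ z ∈ Metric.sphere c r, resolventOp T z * Q =
      (2 * Real.pi * I : ℂ) • resolventOp T z - (2 * Real.pi * I : ℂ) • F z := by
    intro z hz
    have hzb : z ∈ Metric.ball c ρ := Metric.sphere_subset_closedBall.trans
      (Metric.closedBall_subset_ball hrρ) hz
    have hzT : z ∉ spec T := hT z (Metric.ball_subset_closedBall hzb)
      (Metric.ne_of_mem_sphere hz hr.ne')
    have hne : ∀ w ∈ Metric.sphere c ρ, w - z ≠ 0 := by
      intro w hw h
      rw [sub_eq_zero] at h
      subst h
      exact absurd hzb (by rw [Metric.mem_ball, Metric.mem_sphere.mp hw]; exact lt_irrefl _)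
    have h1 : resolventOp T z * Q = ∮ w in C(c, ρ), resolventOp T z * resolventOp T w :=
      (circleIntegral_clm_comp (ContinuousLinearMap.mul ℂ (H →L[ℂ] H) (resolventOp T z)) hiρ).symm
    have h2 : ∀ w ∈ Metric.sphere c ρ, resolventOp T z * resolventOp T w =
        (w - z)⁻¹ • resolventOp T z - (w - z)⁻¹ • resolventOp T w := by
      intro w hw
      have hwT : w ∉ spec T := hT w (Metric.sphere_subset_closedBall hw)
        (Metric.ne_of_mem_sphere hw hρ.ne')
      rw [← smul_sub, (isResolventAt_resolventOp hzT).sub_eq (isResolventAt_resolventOp hwT),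
        smul_smul, inv_mul_cancel₀ (hne w hw), one_smul]
      rfl
    have hinv : ContinuousOn (fun w : ℂ => (w - z)⁻¹) (Metric.sphere c ρ) :=
      (continuousOn_id.sub continuousOn_const).inv₀ hne
    have h3 : CircleIntegrable (fun w => (w - z)⁻¹ • resolventOp T z) c ρ :=
      (hinv.smul continuousOn_const).circleIntegrable hρ.le
    have h4 : CircleIntegrable (fun w => (w - z)⁻¹ • resolventOp T w) c ρ :=
      (hinv.smul hcρ).circleIntegrable hρ.le
    rw [h1, circleIntegral.integral_congr hρ.le h2, circleIntegral.integral_sub h3 h4,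
      circleIntegral.integral_smul_const,
      circleIntegral.integral_sub_inv_of_mem_ball hzb, smul_inv_smul₀ hpi]
  have h3 : (∮ z in C(c, r), resolventOp T z) * Q = ∮ z in C(c, r), resolventOp T z * Q :=
    (circleIntegral_clm_comp ((ContinuousLinearMap.mul ℂ (H →L[ℂ] H)).flip Q) hir).symm
  have h4 : CircleIntegrable (fun z => (2 * Real.pi * I : ℂ) • resolventOp T z) c r :=
    ContinuousOn.circleIntegrable hr.le (by fun_prop)
  have h5 : CircleIntegrable (fun z => (2 * Real.pi * I : ℂ) • F z) c r :=
    ContinuousOn.circleIntegrable hr.le (by fun_prop)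
  rw [h3, circleIntegral.integral_congr hr.le key, circleIntegral.integral_sub h4 h5,
    circleIntegral.integral_smul, circleIntegral.integral_smul, hF0, smul_zero, sub_zero]

/-- The Riesz projection around an isolated point of the spectrum is a projection. -/
theorem rieszProj_mul_self {T : H →ₗ.[ℂ] H} {c : ℂ} {ρ : ℝ} (hρ : 0 < ρ)
    (hT : ∀ z ∈ Metric.closedBall c ρ, z ≠ c → z ∉ spec T) :
    rieszProj T c ρ * rieszProj T c ρ = rieszProj T c ρ := by
  have h := circleIntegral_resolventOp_mul (half_pos hρ) (half_lt_self hρ) hT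
  rw [← circleIntegral_resolventOp_eq (half_pos hρ) (half_lt_self hρ).le hT] at h
  rw [rieszProj, smul_mul_smul_comm, h, smul_smul, mul_assoc,
    inv_mul_cancel₀ Complex.two_pi_I_ne_zero, mul_one]

end Riesz

/-- `Q` is the identity on its closed range, so the identity there is compact and Riesz's theorem
applies. -/
theorem finiteDimensional_range_of_idempotent {X : Type*} [NormedAddCommGroup X]
    [NormedSpace ℂ X] {Q : X →L[ℂ] X} (hQ : Q * Q = Q) (hc : IsCompactOperator Q) :
    FiniteDimensional ℂ Q.range := by
  have h1 : ∀ x ∈ Q.range, Q x = x := by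
    rintro _ ⟨y, rfl⟩
    exact DFunLike.congr_fun hQ y
  have hV : ∀ x ∈ Q.range, (Q : X →ₗ[ℂ] X) x ∈ Q.range := fun x _ => ⟨x, rfl⟩
  have hcl : IsClosed (Q.range : Set X) := by
    have : (Q.range : Set X) = {x | Q x = x} := by
      ext x
      exact ⟨h1 x, fun h => ⟨x, h⟩⟩
    rw [this]
    exact isClosed_eq Q.continuous continuous_id
  have hr := IsCompactOperator.restrict (f := (Q : X →ₗ[ℂ] X)) hc hV hcl
  have e : ((Q : X →ₗ[ℂ] X).restrict hV : Q.range → Q.range) = id := by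
    ext x
    exact h1 x x.2
  rw [e] at hr
  exact FiniteDimensional.of_isCompactOperator_id hr

/-! ### Relatively compact perturbations. -/

section RelativelyCompact

variable {H : Type*} [NormedAddCommGroup H] [InnerProductSpace ℂ H]
  {T₀ T : H →ₗ.[ℂ] H} {B : H →L[ℂ] H}

/-- The second resolvent identity; it makes the difference of the resolvents compact as soon as `B
∘L resolventOp T₀ z` is. -/
theorem resolventOp_sub_resolventOp (hd : T.domain = T₀.domain)
    (hB : ∀ (x : H) (hx : x ∈ T₀.domain) (hx' : x ∈ T.domain), T ⟨x, hx'⟩ = T₀ ⟨x, hx⟩ + B x)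
    {z : ℂ} (hz : z ∉ spec T₀) (hz' : z ∉ spec T) :
    resolventOp T z - resolventOp T₀ z = resolventOp T z ∘L B ∘L resolventOp T₀ z := by
  ext y
  obtain ⟨hy, e⟩ := (isResolventAt_resolventOp hz).1 y
  have h1 := (isResolventAt_resolventOp hz').2 ⟨resolventOp T₀ z y, hd ▸ hy⟩
  have h2 : z • resolventOp T₀ z y - T ⟨resolventOp T₀ z y, hd ▸ hy⟩ =
      y - B (resolventOp T₀ z y) := by
    rw [hB _ hy]
    linear_combination (norm := module) e
  simp only at h1
  rw [h2, map_sub] at h1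
  simp only [sub_apply, ContinuousLinearMap.comp_apply]
  linear_combination (norm := module) h1

variable [CompleteSpace H]

theorem notMem_spec_iff_isUnit (hd : T.domain = T₀.domain)
    (hB : ∀ (x : H) (hx : x ∈ T₀.domain) (hx' : x ∈ T.domain), T ⟨x, hx'⟩ = T₀ ⟨x, hx⟩ + B x)
    {z : ℂ} (hz : z ∉ spec T₀) : z ∉ spec T ↔ IsUnit (1 - B ∘L resolventOp T₀ z) := by
  have hR := isResolventAt_resolventOp hz
  have hS : ∀ (x : H) (hx : x ∈ T₀.domain) (hx' : x ∈ T.domain),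
      z • x - T ⟨x, hx'⟩ = (1 - B ∘L resolventOp T₀ z) (z • x - T₀ ⟨x, hx⟩) := by
    intro x hx hx'
    rw [sub_apply, one_apply_eq_self, ContinuousLinearMap.comp_apply, hR.2 ⟨x, hx⟩, hB x hx hx']
    abel
  constructor
  · intro h
    exact hR.isUnit (isResolventAt_resolventOp h) hd _ hS
  · rintro ⟨S, hSu⟩
    refine (hR.of_unit_mul hd S fun x hx hx' => ?_).notMem_spec
    rw [hSu]
    exact hS x hx hx'

/-- Outside the spectrum of `T₀`, a relatively compact perturbation of `T₀` has only discrete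
spectrum. -/
theorem mem_specDisc_of_notMem_spec (hd : T.domain = T₀.domain)
    (hB : ∀ (x : H) (hx : x ∈ T₀.domain) (hx' : x ∈ T.domain), T ⟨x, hx'⟩ = T₀ ⟨x, hx⟩ + B x)
    (hc : ∀ z ∉ spec T₀, IsCompactOperator (B ∘L resolventOp T₀ z))
    (hconn : IsPreconnected (spec T₀)ᶜ) {w : ℂ} (hw : w ∉ spec T₀)
    (hwn : ‖B ∘L resolventOp T₀ w‖ < 1) {z : ℂ} (hz : z ∈ spec T) (hz₀ : z ∉ spec T₀) :
    z ∈ specDisc T := by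
  have hev : ∀ᶠ z' in 𝓝[≠] z, IsUnit (1 - B ∘L resolventOp T₀ z') := by
    refine analytic_fredholm (isOpen_compl_spec T₀) hconn ?_ hc hw
      (Units.oneSub _ hwn).isUnit hz₀
    exact (ContinuousLinearMap.compL ℂ H H H B).differentiable.comp_differentiableOn
      (differentiableOn_resolventOp T₀)
  obtain ⟨ρ, hρ, hball⟩ := Metric.nhds_basis_closedBall.eventually_iff.mp
    ((eventually_nhdsWithin_iff.mp hev).and ((isOpen_compl_spec T₀).mem_nhds hz₀))
  have hT₀ : ∀ z' ∈ Metric.closedBall z ρ, z' ∉ spec T₀ := fun z' hz' => (hball hz').2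
  have hT : ∀ z' ∈ Metric.closedBall z ρ, z' ≠ z → z' ∉ spec T := fun z' hz' hne =>
    (notMem_spec_iff_isUnit hd hB (hT₀ z' hz')).mpr ((hball hz').1 hne)
  refine ⟨hz, ?_, ρ, hρ, ?_, ?_⟩
  · have hnu : ¬ IsUnit (1 - B ∘L resolventOp T₀ z) := fun h =>
      (notMem_spec_iff_isUnit hd hB hz₀).mpr h hz
    -- For such `y` the vector `x = (z - T₀)⁻¹ y` satisfies `(z - T₀) x = y = B x`, that is, `T x =
    -- z x`.
    obtain ⟨y, hy0, hy⟩ := exists_fixed_of_not_isUnit (hc z hz₀) hnu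
    obtain ⟨hx, e⟩ := (isResolventAt_resolventOp hz₀).1 y
    refine ⟨⟨resolventOp T₀ z y, hd ▸ hx⟩, fun h0 => hy0 ?_, ?_⟩
    · have h0' : resolventOp T₀ z y = 0 := h0
      rw [← hy, ContinuousLinearMap.comp_apply, h0', map_zero]
    · rw [hB _ hx]
      rw [ContinuousLinearMap.comp_apply] at hy
      linear_combination (norm := module) hy - e
  · ext z'
    constructor
    · rintro ⟨h1, h2⟩
      by_contra h3
      exact hT z' h1 h3 h2
    · rintro rfl
      exact ⟨Metric.mem_closedBall_self hρ.le, hz⟩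
  · refine finiteDimensional_range_of_idempotent (rieszProj_mul_self hρ hT) ?_
    -- The resolvent of `T₀` is holomorphic on the whole disc, so it may be subtracted under the
    -- integral; what remains is compact.
    have h0 : (∮ z' in C(z, ρ), resolventOp T₀ z') = 0 := by
      refine circleIntegral_eq_zero_of_differentiable_on_off_countable hρ.le Set.countable_empty
        (fun z' hz' => (continuousAt_resolventOp (hT₀ z' hz')).continuousWithinAt)
        (fun z' hz' => ?_)
      exact (hasDerivAt_resolventOp (hT₀ z' (Metric.ball_subset_closedBall hz'.1))).differentiableAt
    have hi := (continuousOn_sphere_resolventOp hρ le_rfl hT).circleIntegrable hρ.le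
    have hi₀ := (continuousOn_sphere_resolventOp (T := T₀) hρ le_rfl
      fun z' hz' _ => hT₀ z' hz').circleIntegrable hρ.le
    have h1 : (∮ z' in C(z, ρ), resolventOp T z') =
        ∮ z' in C(z, ρ), (resolventOp T z' - resolventOp T₀ z') := by
      rw [circleIntegral.integral_sub hi hi₀, h0, sub_zero]
    have h2 : (∮ z' in C(z, ρ), (resolventOp T z' - resolventOp T₀ z')) ∈
        compactOperator (RingHom.id ℂ) H H := by
      refine circleIntegral_mem isClosed_setOfPred_isCompactOperator hρ.le (hi.sub hi₀)
        fun z' hz' => ?_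
      have hz'' := Metric.sphere_subset_closedBall hz'
      rw [resolventOp_sub_resolventOp hd hB (hT₀ z' hz'')
        (hT z' hz'' (Metric.ne_of_mem_sphere hz' hρ.ne'))]
      exact (hc z' (hT₀ z' hz'')).clm_comp _
    rw [rieszProj, h1]
    exact Submodule.smul_mem (compactOperator (RingHom.id ℂ) H H) _ h2

/-- A point of the spectrum of `T₀` that a relatively compact perturbation moves into the resolvent
set is an eigenvalue of `T₀`. -/
theorem isEigenvalue_of_notMem_spec (hd : T.domain = T₀.domain)
    (hB : ∀ (x : H) (hx : x ∈ T₀.domain) (hx' : x ∈ T.domain), T ⟨x, hx'⟩ = T₀ ⟨x, hx⟩ + B x)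
    {w : ℂ} (hw : w ∉ spec T₀) (hc : IsCompactOperator (B ∘L resolventOp T₀ w)) {z : ℂ}
    (hz : z ∈ spec T₀) (hz' : z ∉ spec T) : IsEigenvalue T₀ z := by
  set R := resolventOp T z with hRdef
  have hR : IsResolventAt T z R := isResolventAt_resolventOp hz'
  -- This is `(w - T₀)(z - T)⁻¹` written as a bounded operator. It carries compactness from `B (w -
  -- T₀)⁻¹` over to `B (z - T)⁻¹`, although `z` lies in `spec T₀`.
  let C : H →L[ℂ] H := (w - z) • R + 1 + B ∘L R
  have hRC : R = resolventOp T₀ w ∘L C := by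
    ext y
    obtain ⟨hy, e⟩ := hR.1 y
    have h1 := (isResolventAt_resolventOp hw).2 ⟨R y, hd ▸ hy⟩
    have h2 : w • R y - T₀ ⟨R y, hd ▸ hy⟩ = C y := by
      rw [hB _ (hd ▸ hy)] at e
      simp only [C, add_apply, smul_apply, one_apply_eq_self, ContinuousLinearMap.comp_apply]
      linear_combination (norm := module) e
    simp only at h1
    rw [h2] at h1
    exact h1.symm
  have hcR : IsCompactOperator (-(B ∘L R) : H →L[ℂ] H) := by
    rw [hRC]
    exact (hc.comp_clm C).neg
  -- `z - T₀ = (1 + B R)(z - T)`, so invertibility of this factor would put `z` in the resolvent set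
  -- of `T₀`.
  have hnu : ¬ IsUnit (1 - -(B ∘L R)) := by
    rintro ⟨S, hS⟩
    refine (hR.of_unit_mul (z' := z) hd.symm S fun x hx hx' => ?_).notMem_spec hz
    rw [hS, sub_neg_eq_add, add_apply, one_apply_eq_self, ContinuousLinearMap.comp_apply,
      hR.2 ⟨x, hx⟩, hB x hx' hx]
    abel
  obtain ⟨y, hy0, hy⟩ := exists_fixed_of_not_isUnit hcR hnu
  obtain ⟨hx, e⟩ := hR.1 y
  have hy' : -(B (R y)) = y := hy
  refine ⟨⟨R y, hd ▸ hx⟩, fun h0 => hy0 ?_, ?_⟩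
  · have h0' : R y = 0 := h0
    rw [← hy', h0', map_zero, neg_zero]
  · rw [hB _ (hd ▸ hx)] at e
    linear_combination (norm := module) hy' - e

end RelativelyCompact

/-! ### Multiplication operators and the matrix `J` on `L²`. -/

section Multiplication

/-- Multiplication by a bounded continuous function on `L²`. -/
def mulOp (g : Plane →ᵇ ℂ) : L2 →L[ℂ] L2 :=
  (ContinuousLinearMap.lsmul ℂ ℂ).holderL (volume : Measure Plane) ∞ 2 2
    (g.memLp_top.toLp (μ := (volume : Measure Plane)))

theorem mulOp_coeFn (g : Plane →ᵇ ℂ) (f : L2) :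
    mulOp g f =ᵐ[volume] fun x => g x • f x := by
  have h := (ContinuousLinearMap.lsmul ℂ ℂ).coeFn_holder (r := 2)
    (g.memLp_top.toLp (μ := (volume : Measure Plane))) f
  filter_upwards [h, g.memLp_top.coeFn_toLp (μ := (volume : Measure Plane))] with x hx hx'
  rw [hx'] at hx
  exact hx

theorem norm_mulOp_le {g : Plane →ᵇ ℂ} {C : ℝ} (hC : 0 ≤ C) (hg : ∀ x, ‖g x‖ ≤ C) :
    ‖mulOp g‖ ≤ C := by
  refine ContinuousLinearMap.opNorm_le_bound _ hC fun f => ?_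
  refine Lp.norm_le_mul_norm_of_ae_le_mul ?_
  filter_upwards [mulOp_coeFn g f] with x hx
  rw [hx, norm_smul]
  gcongr
  exact hg x

theorem mulOp_mul (g h : Plane →ᵇ ℂ) : mulOp (g * h) = mulOp g ∘L mulOp h := by
  ext1 f
  apply Lp.ext
  filter_upwards [mulOp_coeFn (g * h) f, mulOp_coeFn g (mulOp h f), mulOp_coeFn h f] with x h1 h2 h3
  rw [h1, ContinuousLinearMap.comp_apply, h2, h3, smul_smul]
  rfl

theorem mulOp_add (g h : Plane →ᵇ ℂ) : mulOp (g + h) = mulOp g + mulOp h := by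
  ext1 f
  apply Lp.ext
  filter_upwards [mulOp_coeFn (g + h) f, mulOp_coeFn g f, mulOp_coeFn h f,
    Lp.coeFn_add (mulOp g f) (mulOp h f)] with x h1 h2 h3 h4
  have e : (mulOp g + mulOp h) f = mulOp g f + mulOp h f := rfl
  rw [h1, e, h4, Pi.add_apply, h2, h3, ← add_smul]
  rfl

theorem mulOp_smul (c : ℂ) (g : Plane →ᵇ ℂ) : mulOp (c • g) = c • mulOp g := by
  ext1 f
  apply Lp.ext
  filter_upwards [mulOp_coeFn (c • g) f, mulOp_coeFn g f, Lp.coeFn_smul c (mulOp g f)]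
    with x h1 h2 h4
  have e : (c • mulOp g) f = c • mulOp g f := rfl
  rw [h1, e, h4, Pi.smul_apply, h2, smul_smul]
  rfl

theorem mulOp_one : mulOp 1 = 1 := by
  ext1 f
  apply Lp.ext
  filter_upwards [mulOp_coeFn 1 f] with x h1
  rw [h1, one_apply_eq_self]
  simp

theorem eq_zero_of_mulOp_eq_zero {g : Plane →ᵇ ℂ} (hg : ∀ᵐ x ∂(volume : Measure Plane), g x ≠ 0)
    {f : L2} (h : mulOp g f = 0) : f = 0 := by
  apply Lp.ext
  filter_upwards [hg, mulOp_coeFn g f, Lp.coeFn_zero Val 2 (volume : Measure Plane)] with x h1 h2 h3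
  rw [h, h3] at h2
  rw [h3]
  exact (smul_eq_zero.mp h2.symm).resolve_left h1

theorem JL2_coeFn (f : L2) : JL2 f =ᵐ[volume] fun x => act J (f x) :=
  (act J).coeFn_compLpL f

theorem mulOp_JL2 (g : Plane →ᵇ ℂ) (f : L2) : mulOp g (JL2 f) = JL2 (mulOp g f) := by
  apply Lp.ext
  filter_upwards [mulOp_coeFn g f, mulOp_coeFn g (JL2 f), JL2_coeFn f, JL2_coeFn (mulOp g f)]
    with x h1 h2 h3 h4
  rw [h2, h4, h1, h3, map_smul]

theorem act_J_act_J (v : Val) : act J (act J v) = -v := by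
  ext i
  fin_cases i <;> simp [act_apply, J]

theorem norm_act_J (v : Val) : ‖act J v‖ = ‖v‖ := by
  simp [EuclideanSpace.norm_eq, act_apply, J, add_comm]

theorem JL2_JL2 (f : L2) : JL2 (JL2 f) = -f := by
  apply Lp.ext
  filter_upwards [JL2_coeFn f, JL2_coeFn (JL2 f), Lp.coeFn_neg f] with x h1 h2 h3
  rw [h2, h1, act_J_act_J, h3, Pi.neg_apply]

theorem norm_JL2_le : ‖JL2‖ ≤ 1 := by
  refine ContinuousLinearMap.opNorm_le_bound _ zero_le_one fun f => ?_
  refine Lp.norm_le_mul_norm_of_ae_le_mul ?_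
  filter_upwards [JL2_coeFn f] with x hx
  rw [hx, norm_act_J, one_mul]

end Multiplication

/-! ### Fourier multipliers. -/

section Fourier

theorem schwartz_fourier_postcomp (L : Val →L[ℂ] Val) (φ : 𝓢(Plane, Val)) :
    𝓕 (φ.postcompCLM L) = (𝓕 φ).postcompCLM L := by
  ext1 ξ
  rw [SchwartzMap.postcompCLM_apply, SchwartzMap.fourier_coe, SchwartzMap.fourier_coe,
    Real.fourier_eq, Real.fourier_eq, ← L.integral_comp_comm]
  · simp only [SchwartzMap.postcompCLM_apply, Circle.smul_def, map_smul]
  · exact (Real.fourierIntegral_convergent_iff ξ).mpr φ.integrable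

/-- A constant matrix acts on values only and passes through the Fourier integral; density of
Schwartz functions extends this to `L²`. -/
theorem fourier_JL2 (f : L2) : 𝓕 (JL2 f) = JL2 (𝓕 f) := by
  have h1 : ∀ φ : 𝓢(Plane, Val), JL2 (φ.toLp 2) = (φ.postcompCLM (act J)).toLp 2 := by
    intro φ
    apply Lp.ext
    filter_upwards [JL2_coeFn (φ.toLp 2), φ.coeFn_toLp 2 volume,
      (φ.postcompCLM (act J)).coeFn_toLp 2 volume] with x h1 h2 h3
    rw [h1, h2, h3, SchwartzMap.postcompCLM_apply]
  refine DenseRange.induction_on (p := fun f : L2 => 𝓕 (JL2 f) = JL2 (𝓕 f))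
    (SchwartzMap.denseRange_toLpCLM (p := 2) ENNReal.ofNat_ne_top) f ?_ ?_
  · exact isClosed_eq ((FourierTransform.fourierCLM ℂ L2).continuous.comp JL2.continuous)
      (JL2.continuous.comp (FourierTransform.fourierCLM ℂ L2).continuous)
  · intro φ
    rw [SchwartzMap.toLpCLM_apply, h1, SchwartzMap.toLp_fourier_eq, SchwartzMap.toLp_fourier_eq, h1,
      schwartz_fourier_postcomp]

/-- The Fourier multiplier on `L²` with a bounded continuous symbol. -/
def fourierMul (g : Plane →ᵇ ℂ) : L2 →L[ℂ] L2 :=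
  FourierTransform.fourierInvCLM ℂ L2 ∘L mulOp g ∘L FourierTransform.fourierCLM ℂ L2

theorem fourierMul_apply (g : Plane →ᵇ ℂ) (f : L2) : fourierMul g f = 𝓕⁻ (mulOp g (𝓕 f)) := rfl

theorem fourier_fourierMul (g : Plane →ᵇ ℂ) (f : L2) : 𝓕 (fourierMul g f) = mulOp g (𝓕 f) := by
  rw [fourierMul_apply, FourierTransform.fourier_fourierInv_eq]

theorem fourier_injective {f g : L2} (h : 𝓕 f = 𝓕 g) : f = g :=
  (Lp.fourierTransformₗᵢ Plane Val).injective h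

theorem fourierMul_mul (g h : Plane →ᵇ ℂ) (f : L2) :
    fourierMul (g * h) f = fourierMul g (fourierMul h f) := by
  apply fourier_injective
  simp only [fourier_fourierMul, mulOp_mul, ContinuousLinearMap.comp_apply]

theorem fourierMul_add (g h : Plane →ᵇ ℂ) : fourierMul (g + h) = fourierMul g + fourierMul h := by
  simp only [fourierMul, mulOp_add, ContinuousLinearMap.add_comp, ContinuousLinearMap.comp_add]

theorem fourierMul_smul (c : ℂ) (g : Plane →ᵇ ℂ) : fourierMul (c • g) = c • fourierMul g := by
  simp only [fourierMul, mulOp_smul, ContinuousLinearMap.smul_comp, ContinuousLinearMap.comp_smul]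

theorem fourierMul_one : fourierMul 1 = 1 := by
  ext1 f
  apply fourier_injective
  rw [fourier_fourierMul, mulOp_one]
  rfl

theorem fourierMul_JL2 (g : Plane →ᵇ ℂ) (f : L2) : fourierMul g (JL2 f) = JL2 (fourierMul g f) := by
  apply fourier_injective
  simp only [fourier_fourierMul, fourier_JL2, mulOp_JL2]

theorem norm_fourierMul_le {g : Plane →ᵇ ℂ} {C : ℝ} (hC : 0 ≤ C) (hg : ∀ x, ‖g x‖ ≤ C) :
    ‖fourierMul g‖ ≤ C := by
  refine ContinuousLinearMap.opNorm_le_bound _ hC fun f => ?_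
  rw [← Lp.norm_fourier_eq, fourier_fourierMul, ← Lp.norm_fourier_eq f]
  exact (mulOp g).le_of_opNorm_le (norm_mulOp_le hC hg) _

theorem eq_zero_of_fourierMul_eq_zero {g : Plane →ᵇ ℂ}
    (hg : ∀ᵐ x ∂(volume : Measure Plane), g x ≠ 0) {f : L2} (h : fourierMul g f = 0) : f = 0 := by
  apply fourier_injective
  have h1 := fourier_fourierMul g f
  rw [h, FourierTransform.fourier_zero] at h1
  rw [eq_zero_of_mulOp_eq_zero hg h1.symm, FourierTransform.fourier_zero]

/-- Links the `L²` multipliers to the distributional ones by which `H2` and `lap` are defined. -/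
theorem fourierMul_toTemperedDistribution {g : Plane →ᵇ ℂ}
    (hg : Function.HasTemperateGrowth (g : Plane → ℂ)) (f : L2) :
    ((fourierMul g f : L2) : 𝓢'(Plane, Val)) =
      TemperedDistribution.fourierMultiplierCLM Val g (f : 𝓢'(Plane, Val)) := by
  have h : mulOp g (𝓕 f) = (g.memLp_top.toLp _ (μ := (volume : Measure Plane))) • (𝓕 f : L2) := by
    apply Lp.ext
    filter_upwards [mulOp_coeFn g (𝓕 f), g.memLp_top.coeFn_toLp (μ := (volume : Measure Plane)),
      Lp.coeFn_lpSMul (r := 2) (g.memLp_top.toLp _ (μ := (volume : Measure Plane))) (𝓕 f : L2)]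
      with x h1 h2 h3
    rw [h1, h3, Pi.smul_apply', h2]
  rw [fourierMul_apply, h, TemperedDistribution.fourierMultiplierCLM_apply,
    Lp.fourier_toTemperedDistribution_eq, ← Lp.fourierInv_toTemperedDistribution_eq,
    MeasureTheory.Lp.toTemperedDistribution_smul_eq hg]

end Fourier

/-! ### `H²` as the range of the Bessel potential. -/

section Sobolev

/-- The symbol `1 / (1 + |ξ|²)` of the Bessel potential. -/
def besselSymbol : Plane →ᵇ ℂ :=
  BoundedContinuousFunction.ofNormedAddCommGroup
    (fun x : Plane => (((1 + ‖x‖ ^ 2) ^ ((-2 : ℝ) / 2) : ℝ) : ℂ))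
    ((by fun_prop : Function.HasTemperateGrowth
      (fun x : Plane => (((1 + ‖x‖ ^ 2) ^ ((-2 : ℝ) / 2) : ℝ) : ℂ))).1.continuous) 1 (by
      intro x
      rw [Complex.norm_real, Real.norm_eq_abs, abs_of_nonneg (by positivity)]
      exact Real.rpow_le_one_of_one_le_of_nonpos (by simp) (by norm_num))

theorem besselSymbol_hasTemperateGrowth :
    Function.HasTemperateGrowth (besselSymbol : Plane → ℂ) := by
  change Function.HasTemperateGrowth
      (fun x : Plane => (((1 + ‖x‖ ^ 2) ^ ((-2 : ℝ) / 2) : ℝ) : ℂ))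
  fun_prop

theorem besselSymbol_apply (x : Plane) : besselSymbol x = (((1 + ‖x‖ ^ 2)⁻¹ : ℝ) : ℂ) := by
  change (((1 + ‖x‖ ^ 2) ^ ((-2 : ℝ) / 2) : ℝ) : ℂ) = _
  rw [show (-2 : ℝ) / 2 = -1 by norm_num, Real.rpow_neg_one]

theorem besselSymbol_ne_zero (x : Plane) : besselSymbol x ≠ 0 := by
  rw [besselSymbol_apply, Complex.ofReal_ne_zero]
  positivity

/-- The Bessel potential `(1 - Δ / (4π²))⁻¹` as an operator on `L²`. -/
def bessel : L2 →L[ℂ] L2 := fourierMul besselSymbol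

theorem bessel_toTemperedDistribution (f : L2) :
    ((bessel f : L2) : 𝓢'(Plane, Val)) =
      TemperedDistribution.besselPotential Plane Val (-2) (f : 𝓢'(Plane, Val)) :=
  fourierMul_toTemperedDistribution besselSymbol_hasTemperateGrowth f

/-- Parametrizing `H2` by `bessel` turns every statement about operators with domain `H2` into one
about bounded Fourier multipliers. -/
theorem mem_H2_iff (f : L2) : f ∈ H2 ↔ ∃ h : L2, bessel h = f := by
  constructor
  · rintro ⟨h, hh⟩
    refine ⟨h, toTempered_injective ?_⟩
    rw [Lp.toTemperedDistributionCLM_apply, Lp.toTemperedDistributionCLM_apply,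
      bessel_toTemperedDistribution, ← hh]
    simp
  · rintro ⟨h, rfl⟩
    refine ⟨h, ?_⟩
    rw [bessel_toTemperedDistribution]
    simp

theorem bessel_mem_H2 (h : L2) : bessel h ∈ H2 := (mem_H2_iff _).mpr ⟨h, rfl⟩

theorem lap_bessel (h : L2) :
    lap ⟨bessel h, bessel_mem_H2 h⟩ = ((4 * Real.pi ^ 2 : ℝ) : ℂ) • (bessel h - h) := by
  apply toTempered_injective
  have h1 := lap_spec ⟨bessel h, bessel_mem_H2 h⟩
  rw [map_smul, map_sub]
  simp only [Lp.toTemperedDistributionCLM_apply]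
  rw [← h1, bessel_toTemperedDistribution, TemperedDistribution.laplacian_eq_fourierMultiplierCLM,
    TemperedDistribution.besselPotential,
    TemperedDistribution.fourierMultiplierCLM_fourierMultiplierCLM_apply (by fun_prop)
      (by fun_prop)]
  -- The Laplacian has symbol `-4π²|ξ|²`, and `|ξ|² / (1 + |ξ|²) = 1 - 1 / (1 + |ξ|²)`.
  have e : ((fun x : Plane => (((1 + ‖x‖ ^ 2) ^ ((-2 : ℝ) / 2) : ℝ) : ℂ)) *
      fun x : Plane => Complex.ofReal (‖x‖ ^ 2)) =
      (fun _ : Plane => (1 : ℂ)) - fun x : Plane => (((1 + ‖x‖ ^ 2) ^ ((-2 : ℝ) / 2) : ℝ) : ℂ) := by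
    ext x
    simp only [Pi.mul_apply, Pi.sub_apply]
    rw [show (-2 : ℝ) / 2 = -1 by norm_num, Real.rpow_neg_one, ← Complex.ofReal_mul,
      ← Complex.ofReal_one, ← Complex.ofReal_sub]
    congr 1
    have : (1 + ‖x‖ ^ 2) ≠ 0 := by positivity
    field_simp
    ring
  rw [e]
  simp only [TemperedDistribution.fourierMultiplierCLM_apply]
  rw [TemperedDistribution.smulLeftCLM_sub (by fun_prop) (by fun_prop)]
  rw [sub_apply, TemperedDistribution.smulLeftCLM_const, one_smul, sub_eq_add_neg,
    FourierTransform.fourierInv_add, FourierTransform.fourierInv_fourier_eq,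
    FourierTransform.fourierInv_neg, ← Complex.coe_smul]
  push_cast
  module

end Sobolev

/-! ### Compactness of operators with square integrable kernel. -/

section KernelOperator

variable {X H E : Type*} [MeasurableSpace X] {μ : Measure X} [NormedAddCommGroup H]
  [NormedSpace ℂ H] [NormedAddCommGroup E] [NormedSpace ℂ E]

/-- The operator `f ↦ (x ↦ k(x) f)` with a kernel `k ∈ L²(X; H → E)`. -/
def kernelOp (μ : Measure X) : Lp (H →L[ℂ] E) 2 μ →L[ℂ] H →L[ℂ] Lp E 2 μ :=
  ((ContinuousLinearMap.id ℂ (H →L[ℂ] E)).flip.compLpL₂ 2 μ).flip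

theorem kernelOp_coeFn (k : Lp (H →L[ℂ] E) 2 μ) (f : H) :
    kernelOp μ k f =ᵐ[μ] fun x => k x f := by
  have h : kernelOp μ k f =
      ((ContinuousLinearMap.id ℂ (H →L[ℂ] E)).flip f).compLp k := rfl
  rw [h]
  exact ContinuousLinearMap.coeFn_compLp _ k

/-- The kernel of an indicator function factors through the finite-dimensional space `E`. Sums of
these are dense, and compact operators are closed in norm. -/
theorem isCompactOperator_kernelOp [FiniteDimensional ℂ E] (k : Lp (H →L[ℂ] E) 2 μ) :
    IsCompactOperator (kernelOp μ k) := by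
  have : ProperSpace E := FiniteDimensional.proper ℂ E
  have : CompleteSpace E := FiniteDimensional.complete ℂ E
  refine Lp.induction (by norm_num) (motive := fun k => IsCompactOperator (kernelOp μ k))
    (fun c s hs hμs => ?_) (fun f g hf hg _ h1 h2 => ?_) ?_ k
  · let M : E →ₗ[ℂ] Lp E 2 μ :=
      { toFun := fun v => indicatorConstLp 2 hs hμs.ne v
        map_add' := fun v w => (indicatorConstLp_add).symm
        map_smul' := fun a v => by
          apply Lp.ext
          filter_upwards [indicatorConstLp_coeFn (p := 2) (hs := hs) (hμs := hμs.ne) (c := v),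
            indicatorConstLp_coeFn (p := 2) (hs := hs) (hμs := hμs.ne) (c := a • v),
            Lp.coeFn_smul a (indicatorConstLp 2 hs hμs.ne v)] with x h1 h2 h3
          rw [RingHom.id_apply, h2, h3, Pi.smul_apply, h1]
          by_cases hx : x ∈ s <;> simp [hx] }
    have hM : Continuous M := LinearMap.continuous_of_finiteDimensional M
    have e : (kernelOp μ (Lp.simpleFunc.indicatorConst 2 hs hμs.ne c : Lp (H →L[ℂ] E) 2 μ) :
        H → Lp E 2 μ) = M ∘ c := by
      funext f
      apply Lp.ext
      rw [Lp.simpleFunc.coe_indicatorConst]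
      filter_upwards [kernelOp_coeFn (indicatorConstLp 2 hs hμs.ne c) f,
        indicatorConstLp_coeFn (p := 2) (hs := hs) (hμs := hμs.ne) (c := c),
        indicatorConstLp_coeFn (p := 2) (hs := hs) (hμs := hμs.ne) (c := c f)] with x h1 h2 h3
      have e2 : (M ∘ c) f = indicatorConstLp 2 hs hμs.ne (c f) := rfl
      rw [h1, h2, e2, h3]
      by_cases hx : x ∈ s <;> simp [hx]
    rw [e]
    exact ((isCompactOperator_id (E := E)).comp_clm c).continuous_comp hM
  · rw [map_add]
    exact h1.add h2
  · exact isClosed_setOfPred_isCompactOperator.preimage (kernelOp μ).continuous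

end KernelOperator

/-! ### Local compactness of the Bessel potential. -/

section PointEvaluation

theorem besselSymbol_memLp : MemLp (besselSymbol : Plane → ℂ) 2 volume := by
  rw [memLp_two_iff_integrable_sq_norm besselSymbol.continuous.aestronglyMeasurable]
  -- The squared symbol decays like `|ξ|⁻⁴`, and `4` exceeds the dimension `2`.
  have h := integrable_rpow_neg_one_add_norm_sq (E := Plane) (μ := volume) (r := 4)
    (by simp; norm_num)
  refine h.congr (ae_of_all _ fun x => ?_)
  simp only
  rw [besselSymbol_apply, Complex.norm_real, Real.norm_eq_abs, sq_abs,
    show (-4 : ℝ) / 2 = ((-2 : ℤ) : ℝ) by norm_num, Real.rpow_intCast, inv_pow]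
  rfl

/-- The function `ξ ↦ e^{2πi x·ξ} / (1 + |ξ|²)`. -/
def waveSymbol (x ξ : Plane) : ℂ := (Real.fourierChar (inner ℝ ξ x) : ℂ) * besselSymbol ξ

theorem continuous_waveSymbol : Continuous fun p : Plane × Plane => waveSymbol p.1 p.2 := by
  unfold waveSymbol
  have h : Continuous fun p : Plane × Plane => (Real.fourierChar (inner ℝ p.2 p.1) : ℂ) :=
    continuous_subtype_val.comp
      (Real.continuous_fourierChar.comp (continuous_snd.inner continuous_fst))
  exact h.mul (besselSymbol.continuous.comp continuous_snd)

theorem norm_waveSymbol (x ξ : Plane) : ‖waveSymbol x ξ‖ = ‖besselSymbol ξ‖ := by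
  rw [waveSymbol, norm_mul, Circle.norm_coe, one_mul]

theorem waveSymbol_memLp (x : Plane) : MemLp (waveSymbol x) 2 volume :=
  besselSymbol_memLp.of_le
    (continuous_waveSymbol.comp (Continuous.prodMk_right x)).aestronglyMeasurable
    (ae_of_all _ fun ξ => (norm_waveSymbol x ξ).le)

theorem continuous_integral_norm_sub_waveSymbol_sq (y : Plane) :
    Continuous fun x => ∫ ξ, ‖waveSymbol x ξ - waveSymbol y ξ‖ ^ 2 := by
  have hl : ∀ ξ, Continuous fun x => waveSymbol x ξ := by
    intro ξ
    have h : Continuous fun x => (Real.fourierChar (inner ℝ ξ x) : ℂ) :=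
      continuous_subtype_val.comp
        (Real.continuous_fourierChar.comp (continuous_const.inner continuous_id))
    exact h.mul continuous_const
  refine continuous_of_dominated (bound := fun ξ => 4 * ‖besselSymbol ξ‖ ^ 2)
    (fun x => ?_) (fun x => ae_of_all _ fun ξ => ?_) ?_ (ae_of_all _ fun ξ => ?_)
  · exact ((((waveSymbol_memLp x).1.sub (waveSymbol_memLp y).1).norm).pow 2)
  · have h := norm_sub_le (waveSymbol x ξ) (waveSymbol y ξ)
    rw [norm_waveSymbol, norm_waveSymbol] at h
    rw [Real.norm_eq_abs, abs_of_nonneg (by positivity)]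
    nlinarith [norm_nonneg (waveSymbol x ξ - waveSymbol y ξ), norm_nonneg (besselSymbol ξ)]
  · exact ((memLp_two_iff_integrable_sq_norm
      besselSymbol.continuous.aestronglyMeasurable).mp besselSymbol_memLp).const_mul 4
  · exact ((hl ξ).sub continuous_const).norm.pow 2

theorem norm_waveSymbol_toLp_sub (x y : Plane) :
    ‖(waveSymbol_memLp x).toLp - (waveSymbol_memLp y).toLp‖ =
      √(∫ ξ, ‖waveSymbol x ξ - waveSymbol y ξ‖ ^ 2) := by
  have h0 : 0 ≤ ∫ ξ, ‖waveSymbol x ξ - waveSymbol y ξ‖ ^ 2 :=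
    integral_nonneg fun ξ => by positivity
  rw [← MemLp.toLp_sub, Lp.norm_toLp, ((waveSymbol_memLp x).sub
    (waveSymbol_memLp y)).eLpNorm_eq_integral_rpow_norm (by norm_num) (by norm_num)]
  simp only [ENNReal.toReal_ofNat, Real.rpow_ofNat, Pi.sub_apply]
  rw [ENNReal.toReal_ofReal (Real.rpow_nonneg h0 _), Real.sqrt_eq_rpow, one_div]

/-- Dominated convergence, with majorant `4 / (1 + |ξ|²)²`. It makes `besselEval` continuous in
operator norm, so that a compactly supported multiple is a square integrable kernel. -/
theorem continuous_waveSymbol_toLp : Continuous fun x => (waveSymbol_memLp x).toLp := by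
  rw [continuous_iff_continuousAt]
  intro y
  rw [ContinuousAt, tendsto_iff_norm_sub_tendsto_zero]
  simp only [norm_waveSymbol_toLp_sub]
  have h0 := (continuous_integral_norm_sub_waveSymbol_sq y).sqrt.tendsto y
  have h1 : √(∫ ξ, ‖waveSymbol y ξ - waveSymbol y ξ‖ ^ 2) = 0 := by simp
  rwa [h1] at h0

/-- The value at `x` of `(1 - Δ / (4π²))⁻¹ f`, given by Fourier inversion. -/
def besselEval (x : Plane) : L2 →L[ℂ] Val :=
  (ContinuousLinearMap.lsmul ℂ ℂ).lpPairing (volume : Measure Plane) 2 2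
    (waveSymbol_memLp x).toLp ∘L FourierTransform.fourierCLM ℂ L2

theorem continuous_besselEval : Continuous besselEval :=
  (((ContinuousLinearMap.lsmul ℂ ℂ).lpPairing (volume : Measure Plane) 2 2).continuous.comp
    continuous_waveSymbol_toLp).clm_comp continuous_const

theorem bessel_toLp (φ : 𝓢(Plane, Val)) : bessel (φ.toLp 2) =
    (𝓕⁻ (SchwartzMap.smulLeftCLM Val (besselSymbol : Plane → ℂ) (𝓕 φ))).toLp 2 := by
  rw [← SchwartzMap.toLp_fourierInv_eq, bessel, fourierMul_apply, SchwartzMap.toLp_fourier_eq]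
  congr 1
  apply Lp.ext
  filter_upwards [mulOp_coeFn besselSymbol ((𝓕 φ).toLp 2), (𝓕 φ).coeFn_toLp 2 volume,
    (SchwartzMap.smulLeftCLM Val (besselSymbol : Plane → ℂ) (𝓕 φ)).coeFn_toLp 2 volume]
    with x h1 h2 h3
  rw [h1, h2, h3, SchwartzMap.smulLeftCLM_apply_apply besselSymbol_hasTemperateGrowth]

theorem besselEval_toLp (φ : 𝓢(Plane, Val)) (x : Plane) : besselEval x (φ.toLp 2) =
    𝓕⁻ (SchwartzMap.smulLeftCLM Val (besselSymbol : Plane → ℂ) (𝓕 φ)) x := by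
  have h : besselEval x (φ.toLp 2) = (ContinuousLinearMap.lsmul ℂ ℂ).lpPairing
      (volume : Measure Plane) 2 2 (waveSymbol_memLp x).toLp (𝓕 (φ.toLp 2)) := rfl
  rw [h, ContinuousLinearMap.lpPairing_eq_integral, SchwartzMap.toLp_fourier_eq,
    SchwartzMap.fourierInv_coe, Real.fourierInv_eq]
  apply integral_congr_ae
  filter_upwards [(waveSymbol_memLp x).coeFn_toLp, (𝓕 φ).coeFn_toLp 2 volume] with ξ h1 h2
  rw [h1, h2, SchwartzMap.smulLeftCLM_apply_apply besselSymbol_hasTemperateGrowth,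
    ContinuousLinearMap.lsmul_apply, waveSymbol, mul_smul, Circle.smul_def]

theorem mulOp_bessel_toLp (χ : Plane →ᵇ ℂ) (φ : 𝓢(Plane, Val)) :
    mulOp χ (bessel (φ.toLp 2)) =ᵐ[volume] fun x => χ x • besselEval x (φ.toLp 2) := by
  filter_upwards [mulOp_coeFn χ (bessel (φ.toLp 2)),
    (𝓕⁻ (SchwartzMap.smulLeftCLM Val (besselSymbol : Plane → ℂ) (𝓕 φ))).coeFn_toLp 2 volume]
    with x h1 h2
  rw [h1, bessel_toLp, h2, besselEval_toLp]

theorem exists_besselKernel {χ : Plane →ᵇ ℂ} (hχ : HasCompactSupport χ) :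
    ∃ k : Lp (L2 →L[ℂ] Val) 2 (volume : Measure Plane),
      k =ᵐ[volume] fun x => χ x • besselEval x := by
  have hkc : Continuous fun x => χ x • besselEval x := χ.continuous.smul continuous_besselEval
  have hks : HasCompactSupport fun x => χ x • besselEval x := by
    refine HasCompactSupport.intro hχ fun x hx => ?_
    rw [image_eq_zero_of_notMem_tsupport hx]
    exact zero_smul ℂ (besselEval x)
  have hk : MemLp (fun x => χ x • besselEval x) 2 (volume : Measure Plane) :=
    hkc.memLp_of_hasCompactSupport hks
  exact ⟨hk.toLp _, hk.coeFn_toLp⟩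

/-- On Schwartz functions, Fourier inversion holds pointwise and identifies the operator with a
kernel operator; density does the rest. -/
theorem isCompactOperator_mulOp_bessel {χ : Plane →ᵇ ℂ} (hχ : HasCompactSupport χ) :
    IsCompactOperator (mulOp χ ∘L bessel) := by
  obtain ⟨k, hk⟩ := exists_besselKernel hχ
  obtain ⟨T, hT, hTc⟩ : ∃ T : L2 →L[ℂ] L2,
      (∀ f, T f =ᵐ[volume] fun x => k x f) ∧ IsCompactOperator T :=
    ⟨kernelOp volume k, kernelOp_coeFn k, isCompactOperator_kernelOp k⟩
  have hs : ∀ φ : 𝓢(Plane, Val), (mulOp χ ∘L bessel) (φ.toLp 2) = T (φ.toLp 2) := by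
    intro φ
    apply Lp.ext
    filter_upwards [mulOp_bessel_toLp χ φ, hT (φ.toLp 2), hk] with x h1 h2 h3
    rw [ContinuousLinearMap.comp_apply, h1, h2, h3]
    rfl
  have e : mulOp χ ∘L bessel = T :=
    ContinuousLinearMap.ext fun f => DenseRange.induction_on
      (SchwartzMap.denseRange_toLpCLM (p := 2) ENNReal.ofNat_ne_top) f
      (isClosed_eq (mulOp χ ∘L bessel).continuous T.continuous) hs
  rw [e]
  exact hTc

end PointEvaluation

/-! ### Decay and relative compactness of the potential. -/

section Potential

theorem norm_act_le {M : Matrix (Fin 2) (Fin 2) ℝ} {c : ℝ} (hM : ∀ i j, |M i j| ≤ c) (v : Val) :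
    ‖act M v‖ ≤ 4 * c * ‖v‖ := by
  have hc : 0 ≤ c := (abs_nonneg _).trans (hM 0 0)
  have h1 : ∀ i, ‖act M v i‖ ≤ 2 * c * ‖v‖ := by
    intro i
    rw [act_apply]
    refine (norm_add_le _ _).trans ?_
    rw [norm_mul, norm_mul, Complex.norm_real, Complex.norm_real, Real.norm_eq_abs,
      Real.norm_eq_abs]
    have h0 := mul_le_mul (hM i 0) (PiLp.norm_apply_le v 0) (norm_nonneg _) hc
    have h1 := mul_le_mul (hM i 1) (PiLp.norm_apply_le v 1) (norm_nonneg _) hc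
    linarith
  have h2 : act M v = EuclideanSpace.single 0 (act M v 0) + EuclideanSpace.single 1 (act M v 1) := by
    ext i
    fin_cases i <;> simp
  rw [h2]
  refine (norm_add_le _ _).trans ?_
  rw [PiLp.norm_single, PiLp.norm_single]
  linarith [h1 0, h1 1]

theorem tendsto_w (P : Wave) : Tendsto (fun x : Plane => P.w ‖x‖) (cocompact Plane) (𝓝 0) := by
  obtain ⟨C, κ, hκ, h⟩ := P.decay_w
  have h1 : Tendsto (fun r : ℝ => C * Real.exp (-κ * r)) atTop (𝓝 0) := by
    have := (Real.tendsto_exp_atBot.comp (tendsto_id.const_mul_atTop_of_neg (neg_lt_zero.mpr hκ)))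
    simpa using this.const_mul C
  exact squeeze_zero_norm (fun x => h ‖x‖ (norm_nonneg x)) (h1.comp (tendsto_norm_cocompact_atTop))

/-- `α` and `β` are continuous and vanish at `0`, and `w` tends to `0`, while the rotation factor
stays bounded. The jump of the polar angle plays no role. -/
theorem matrixField_small (P : Wave) {ε : ℝ} (hε : 0 < ε) :
    ∃ r : ℝ, ∀ x : Plane, r ≤ ‖x‖ → ∀ i j, |P.matrixField x i j| ≤ ε := by
  have h3 : ∀ i j, ∃ B : ℝ, ∀ x : Plane,
      |(NormedSpace.exp ((2 * (P.m : ℝ) * theta x) • J) * R) i j| ≤ B := by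
    intro i j
    obtain ⟨C, hC⟩ := (isCompact_Icc (a := -Real.pi) (b := Real.pi)).exists_bound_of_continuousOn
      ((rot_continuous R i j).comp (continuous_const_mul (2 * (P.m : ℝ)))).continuousOn
    exact ⟨C, fun x => hC _ (theta_mem x)⟩
  have h4 : ∀ i j, ∀ᶠ x in cocompact Plane, |P.matrixField x i j| ≤ ε := by
    intro i j
    obtain ⟨B, hB⟩ := h3 i j
    have ha : Tendsto (fun x => alpha P.g (P.w ‖x‖)) (cocompact Plane) (𝓝 0) := by
      have := ((alpha_continuous P).tendsto 0).comp (tendsto_w P)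
      rwa [show alpha P.g 0 = 0 by simp [alpha]] at this
    have hb : Tendsto (fun x => beta P.g (P.w ‖x‖)) (cocompact Plane) (𝓝 0) := by
      have := ((beta_continuous P).tendsto 0).comp (tendsto_w P)
      rwa [show beta P.g 0 = 0 by simp [beta]] at this
    have hlim : Tendsto (fun x => |alpha P.g (P.w ‖x‖)| * |(1 : Matrix (Fin 2) (Fin 2) ℝ) i j| +
        |beta P.g (P.w ‖x‖)| * B) (cocompact Plane) (𝓝 0) := by
      have := (ha.abs.mul_const |(1 : Matrix (Fin 2) (Fin 2) ℝ) i j|).add (hb.abs.mul_const B)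
      simpa using this
    filter_upwards [hlim.eventually (ge_mem_nhds hε)] with x hx
    refine le_trans ?_ hx
    rw [matrixField_apply]
    refine (abs_add_le _ _).trans ?_
    rw [abs_mul, abs_mul]
    gcongr
    exact hB x
  have h5 : ∀ᶠ x in cocompact Plane, ∀ i j, |P.matrixField x i j| ≤ ε := by
    simpa only [eventually_all] using h4
  rw [← Metric.cobounded_eq_cocompact, ← comap_norm_atTop] at h5
  obtain ⟨r, hr⟩ := eventually_atTop.mp (eventually_comap.mp h5)
  exact ⟨r, fun x hx => hr ‖x‖ hx x rfl⟩

theorem norm_potential_le (P : Wave) : ∃ C : ℝ, ∀ f : L2, ‖P.potential f‖ ≤ C * ‖f‖ := by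
  obtain ⟨B, hB⟩ := matrixField_bounded P
  refine ⟨4 * B, fun f => Lp.norm_le_mul_norm_of_ae_le_mul ?_⟩
  filter_upwards [potential_coeFn P f] with x hx
  rw [hx]
  exact norm_act_le (hB x) _

/-- Multiplication by `α(w(r)) + β(w(r)) e^{2mθJ} R` as a bounded operator. -/
def Wave.potentialL (P : Wave) : L2 →L[ℂ] L2 :=
  P.potential.mkContinuousOfExistsBound (norm_potential_le P)

/-- A continuous cutoff function that is `1` on the ball of radius `r`. -/
def cutoff (r : ℝ) : Plane →ᵇ ℂ :=
  BoundedContinuousFunction.ofNormedAddCommGroup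
    (fun x : Plane => ((max 0 (min 1 (r + 1 - ‖x‖)) : ℝ) : ℂ)) (by fun_prop) 1 (by
      intro x
      rw [Complex.norm_real, Real.norm_eq_abs, abs_of_nonneg (le_max_left _ _)]
      simp)

theorem cutoff_apply (r : ℝ) (x : Plane) :
    cutoff r x = ((max 0 (min 1 (r + 1 - ‖x‖)) : ℝ) : ℂ) := rfl

theorem hasCompactSupport_cutoff (r : ℝ) : HasCompactSupport (cutoff r) := by
  refine HasCompactSupport.intro (isCompact_closedBall (0 : Plane) (r + 1)) fun x hx => ?_
  rw [Metric.mem_closedBall, dist_zero_right, not_le] at hx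
  rw [cutoff_apply, min_eq_right (by linarith), max_eq_left (by linarith), Complex.ofReal_zero]

theorem cutoff_eq_one {r : ℝ} {x : Plane} (hx : ‖x‖ ≤ r) : cutoff r x = 1 := by
  rw [cutoff_apply, min_eq_left (by linarith), max_eq_right zero_le_one, Complex.ofReal_one]

theorem norm_one_sub_cutoff_le (r : ℝ) (x : Plane) : ‖1 - cutoff r x‖ ≤ 1 := by
  rw [cutoff_apply, ← Complex.ofReal_one, ← Complex.ofReal_sub, Complex.norm_real,
    Real.norm_eq_abs, abs_le]
  have h1 : max 0 (min 1 (r + 1 - ‖x‖)) ≤ 1 := max_le zero_le_one (min_le_left _ _)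
  have h2 : 0 ≤ max 0 (min 1 (r + 1 - ‖x‖)) := le_max_left _ _
  constructor <;> linarith

theorem exists_norm_potentialL_sub_le (P : Wave) {ε : ℝ} (hε : 0 < ε) :
    ∃ r : ℝ, ‖P.potentialL - P.potentialL ∘L mulOp (cutoff r)‖ ≤ ε := by
  -- The `4` offsets the constant in `norm_act_le`.
  obtain ⟨r, hr⟩ := matrixField_small P (ε := ε / 4) (by positivity)
  refine ⟨r, ContinuousLinearMap.opNorm_le_bound _ hε.le fun f => ?_⟩
  have e : (P.potentialL - P.potentialL ∘L mulOp (cutoff r)) f =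
      P.potential (f - mulOp (cutoff r) f) := by
    rw [map_sub]
    rfl
  rw [e]
  refine Lp.norm_le_mul_norm_of_ae_le_mul ?_
  filter_upwards [potential_coeFn P (f - mulOp (cutoff r) f), mulOp_coeFn (cutoff r) f,
    Lp.coeFn_sub f (mulOp (cutoff r) f)] with x h1 h2 h3
  have h4 : f x - cutoff r x • f x = (1 - cutoff r x) • f x := by module
  rw [h1, h3, Pi.sub_apply, h2, h4]
  rcases le_total ‖x‖ r with hx | hx
  · rw [cutoff_eq_one hx, sub_self, zero_smul, map_zero, norm_zero]
    positivity
  · refine (norm_act_le (hr x hx) _).trans ?_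
    rw [norm_smul]
    have := mul_le_mul_of_nonneg_right (norm_one_sub_cutoff_le r x) (norm_nonneg (f x))
    nlinarith

theorem isCompactOperator_potentialL_bessel (P : Wave) :
    IsCompactOperator (P.potentialL ∘L bessel) := by
  have hcl : IsClosed {T : L2 →L[ℂ] L2 | IsCompactOperator T} :=
    isClosed_setOfPred_isCompactOperator
  refine hcl.closure_subset (Metric.mem_closure_iff.mpr fun ε hε => ?_)
  have hε' : 0 < ε / (2 * (‖bessel‖ + 1)) := by positivity
  obtain ⟨r, hr⟩ := exists_norm_potentialL_sub_le P hε'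
  refine ⟨P.potentialL ∘L (mulOp (cutoff r) ∘L bessel),
    (isCompactOperator_mulOp_bessel (hasCompactSupport_cutoff r)).clm_comp P.potentialL, ?_⟩
  rw [dist_eq_norm, ← ContinuousLinearMap.comp_assoc, ← ContinuousLinearMap.sub_comp]
  calc _ ≤ ‖P.potentialL - P.potentialL ∘L mulOp (cutoff r)‖ * ‖bessel‖ :=
        ContinuousLinearMap.opNorm_comp_le _ _
    _ ≤ ε / (2 * (‖bessel‖ + 1)) * (‖bessel‖ + 1) := by
        gcongr
        linarith
    _ = ε / 2 := by field_simp
    _ < ε := half_lt_self hε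

end Potential

/-! ### Spectrum and resolvent of the free operator. -/

section FreeOperator

/-- The symbol `(σ² + 4π²|ξ|²) / (1 + |ξ|²)` of `(σ² - Δ)(1 - Δ / (4π²))⁻¹`. -/
def freeSymbol (σ : ℝ) : Plane →ᵇ ℂ :=
  ((4 * Real.pi ^ 2 : ℝ) : ℂ) • 1 + ((σ ^ 2 - 4 * Real.pi ^ 2 : ℝ) : ℂ) • besselSymbol

theorem freeSymbol_apply (σ : ℝ) (ξ : Plane) :
    freeSymbol σ ξ = ((σ ^ 2 + 4 * Real.pi ^ 2 * ‖ξ‖ ^ 2 : ℝ) : ℂ) * besselSymbol ξ := by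
  have h : freeSymbol σ ξ = ((4 * Real.pi ^ 2 : ℝ) : ℂ) * 1 +
    ((σ ^ 2 - 4 * Real.pi ^ 2 : ℝ) : ℂ) * besselSymbol ξ := rfl
  rw [h, besselSymbol_apply, ← Complex.ofReal_mul, ← Complex.ofReal_mul, mul_one,
    ← Complex.ofReal_add]
  congr 1
  have : 1 + ‖ξ‖ ^ 2 ≠ 0 := by positivity
  field_simp
  ring

theorem opA0_bessel (σ : ℝ) (h : L2) :
    opA0 σ ⟨bessel h, bessel_mem_H2 h⟩ = -JL2 (fourierMul (freeSymbol σ) h) := by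
  have e : opA0 σ ⟨bessel h, bessel_mem_H2 h⟩ =
      JL2 (lap ⟨bessel h, bessel_mem_H2 h⟩ - ((σ : ℂ) ^ 2) • bessel h) := rfl
  rw [e, lap_bessel, ← map_neg, freeSymbol, fourierMul_add, fourierMul_smul, fourierMul_smul,
    fourierMul_one]
  congr 1
  simp only [add_apply, smul_apply, one_apply_eq_self]
  rw [← bessel]
  push_cast
  module

/-- The operator `(z + J (σ² - Δ)) (1 - Δ / (4π²))⁻¹`. -/
def shiftedFree (σ : ℝ) (z : ℂ) : L2 →L[ℂ] L2 :=
  z • bessel + JL2 ∘L fourierMul (freeSymbol σ)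

/-- The operator `(z - J (σ² - Δ)) (1 - Δ / (4π²))⁻¹`. -/
def shiftedFreeConj (σ : ℝ) (z : ℂ) : L2 →L[ℂ] L2 :=
  z • bessel - JL2 ∘L fourierMul (freeSymbol σ)

/-- The symbol of the product of `shiftedFree` and `shiftedFreeConj`. -/
def detSymbol (σ : ℝ) (z : ℂ) : Plane →ᵇ ℂ :=
  z ^ 2 • (besselSymbol * besselSymbol) + freeSymbol σ * freeSymbol σ

theorem detSymbol_apply (σ : ℝ) (z : ℂ) (ξ : Plane) :
    detSymbol σ z ξ = z ^ 2 * besselSymbol ξ ^ 2 + freeSymbol σ ξ ^ 2 := by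
  have h : detSymbol σ z ξ = z ^ 2 * (besselSymbol ξ * besselSymbol ξ) +
    freeSymbol σ ξ * freeSymbol σ ξ := rfl
  rw [h]
  ring

theorem sub_opA0_bessel (σ : ℝ) (z : ℂ) (h : L2) :
    z • bessel h - opA0 σ ⟨bessel h, bessel_mem_H2 h⟩ = shiftedFree σ z h := by
  rw [opA0_bessel, sub_neg_eq_add]
  rfl

/-- Since `J² = -1`, `(z - J l)(z + J l) = z² + l²`: the matrix symbol is inverted through a scalar
one. -/
theorem shiftedFreeConj_shiftedFree (σ : ℝ) (z : ℂ) (h : L2) :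
    shiftedFreeConj σ z (shiftedFree σ z h) = fourierMul (detSymbol σ z) h := by
  have h1 : fourierMul (freeSymbol σ) (bessel h) = bessel (fourierMul (freeSymbol σ) h) := by
    rw [bessel, ← fourierMul_mul, ← fourierMul_mul, mul_comm]
  have h2 : bessel (JL2 (fourierMul (freeSymbol σ) h)) =
      JL2 (bessel (fourierMul (freeSymbol σ) h)) := fourierMul_JL2 _ _
  simp only [shiftedFree, shiftedFreeConj, detSymbol, sub_apply, add_apply, smul_apply,
    ContinuousLinearMap.comp_apply, map_add, map_smul, fourierMul_add, fourierMul_smul,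
    fourierMul_mul, fourierMul_JL2, JL2_JL2]
  rw [h1, h2, ← bessel]
  module

theorem shiftedFree_shiftedFreeConj (σ : ℝ) (z : ℂ) (h : L2) :
    shiftedFree σ z (shiftedFreeConj σ z h) = fourierMul (detSymbol σ z) h := by
  have h1 : fourierMul (freeSymbol σ) (bessel h) = bessel (fourierMul (freeSymbol σ) h) := by
    rw [bessel, ← fourierMul_mul, ← fourierMul_mul, mul_comm]
  have h2 : bessel (JL2 (fourierMul (freeSymbol σ) h)) =
      JL2 (bessel (fourierMul (freeSymbol σ) h)) := fourierMul_JL2 _ _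
  simp only [shiftedFree, shiftedFreeConj, detSymbol, sub_apply, add_apply, smul_apply,
    ContinuousLinearMap.comp_apply, map_sub, map_smul, fourierMul_add, fourierMul_smul,
    fourierMul_mul, fourierMul_JL2, JL2_JL2]
  rw [h1, h2, ← bessel]
  module

theorem fourierMul_shiftedFree (g : Plane →ᵇ ℂ) (σ : ℝ) (z : ℂ) (h : L2) :
    fourierMul g (shiftedFree σ z h) = shiftedFree σ z (fourierMul g h) := by
  simp only [shiftedFree, add_apply, smul_apply, ContinuousLinearMap.comp_apply, map_add, map_smul,
    fourierMul_JL2, bessel]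
  rw [← fourierMul_mul, ← fourierMul_mul, ← fourierMul_mul, ← fourierMul_mul, mul_comm g,
    mul_comm g]

theorem isResolventAt_opA0 {σ : ℝ} {z : ℂ} {g : Plane →ᵇ ℂ} (hg : detSymbol σ z * g = 1) :
    IsResolventAt (opA0 σ) z (bessel ∘L shiftedFreeConj σ z ∘L fourierMul g) := by
  constructor
  · intro y
    refine ⟨bessel_mem_H2 _, ?_⟩
    have e := sub_opA0_bessel σ z (shiftedFreeConj σ z (fourierMul g y))
    rw [shiftedFree_shiftedFreeConj, ← fourierMul_mul, hg, fourierMul_one] at e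
    exact e
  · rintro ⟨x, hx⟩
    obtain ⟨h, rfl⟩ := (mem_H2_iff x).mp hx
    have e := sub_opA0_bessel σ z h
    simp only
    rw [e]
    simp only [ContinuousLinearMap.comp_apply]
    rw [fourierMul_shiftedFree, shiftedFreeConj_shiftedFree, ← fourierMul_mul, hg, fourierMul_one]
    rfl

/-- The two half-lines `{it : |t| ≥ σ²}`. -/
def halfLines (σ : ℝ) : Set ℂ := {z : ℂ | ∃ t : ℝ, σ ^ 2 ≤ |t| ∧ z = Complex.I * t}

theorem mem_halfLines_of_sq_add_sq_eq_zero {σ p : ℝ} (hp : σ ^ 2 ≤ p) {z : ℂ}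
    (h : z ^ 2 + (p : ℂ) ^ 2 = 0) : z ∈ halfLines σ := by
  have hp0 : 0 ≤ p := (sq_nonneg σ).trans hp
  have h1 : (z - I * p) * (z + I * p) = 0 := by
    linear_combination h - (p : ℂ) ^ 2 * Complex.I_sq
  rcases mul_eq_zero.mp h1 with h2 | h2
  · exact ⟨p, by rwa [abs_of_nonneg hp0], sub_eq_zero.mp h2⟩
  · refine ⟨-p, by rwa [abs_neg, abs_of_nonneg hp0], ?_⟩
    push_cast
    linear_combination h2

theorem exists_detSymbol_inv {σ : ℝ} {z : ℂ} (hz : z ∉ halfLines σ) :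
    ∃ g : Plane →ᵇ ℂ, detSymbol σ z * g = 1 := by
  -- In the variable `s = 1 / (1 + |ξ|²)` the symbol is a polynomial. Adding `s = 0`, the point `|ξ|
  -- = ∞` with value `16π⁴`, gives a compact interval, on which a nonvanishing symbol has bounded
  -- inverse.
  let l : ℝ → ℝ := fun s => 4 * Real.pi ^ 2 + (σ ^ 2 - 4 * Real.pi ^ 2) * s
  let D : ℝ → ℂ := fun s => z ^ 2 * (s : ℂ) ^ 2 + (l s : ℂ) ^ 2
  have hDc : Continuous D := by fun_prop
  have hD : ∀ s ∈ Set.Icc (0 : ℝ) 1, D s ≠ 0 := by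
    intro s hs h0
    rcases hs.1.eq_or_lt with h | h
    · rw [← h] at h0
      have : (4 : ℂ) * (Real.pi : ℂ) ^ 2 ≠ 0 := by
        have := Real.pi_ne_zero
        simp [this]
      simp [D, l] at h0
    -- Here `l s / s = σ² + 4π² (1 - s) / s`, which is `σ² + 4π²|ξ|²`.
    · refine hz (mem_halfLines_of_sq_add_sq_eq_zero (p := l s / s) ?_ ?_)
      · rw [le_div_iff₀ h]
        have : 0 ≤ 4 * Real.pi ^ 2 * (1 - s) := by
          have := sub_nonneg.mpr hs.2
          positivity
        simp only [l]
        linarith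
      · have hs' : (s : ℂ) ≠ 0 := by exact_mod_cast h.ne'
        have h2 : (z ^ 2 + ((l s / s : ℝ) : ℂ) ^ 2) * (s : ℂ) ^ 2 = D s := by
          push_cast
          field_simp
          rfl
        rw [h0] at h2
        exact (mul_eq_zero.mp h2).resolve_right (pow_ne_zero 2 hs')
  have hDξ : ∀ ξ, detSymbol σ z ξ = D ((1 + ‖ξ‖ ^ 2)⁻¹) := by
    intro ξ
    have h1 : freeSymbol σ ξ = ((4 * Real.pi ^ 2 : ℝ) : ℂ) * 1 +
      ((σ ^ 2 - 4 * Real.pi ^ 2 : ℝ) : ℂ) * besselSymbol ξ := rfl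
    rw [detSymbol_apply, h1, besselSymbol_apply]
    simp only [D, l]
    push_cast
    ring
  have hmem : ∀ ξ : Plane, (1 + ‖ξ‖ ^ 2)⁻¹ ∈ Set.Icc (0 : ℝ) 1 := fun ξ =>
    ⟨by positivity, inv_le_one_of_one_le₀ (by nlinarith [sq_nonneg ‖ξ‖])⟩
  obtain ⟨C, hC⟩ := (isCompact_Icc (a := (0 : ℝ)) (b := 1)).exists_bound_of_continuousOn
    (hDc.continuousOn.inv₀ hD)
  have hne : ∀ ξ, detSymbol σ z ξ ≠ 0 := fun ξ => by
    rw [hDξ]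
    exact hD _ (hmem ξ)
  refine ⟨BoundedContinuousFunction.ofNormedAddCommGroup (fun ξ => (detSymbol σ z ξ)⁻¹)
    ((detSymbol σ z).continuous.inv₀ hne) C fun ξ => ?_, ?_⟩
  · rw [hDξ]
    exact hC _ (hmem ξ)
  · ext ξ
    exact mul_inv_cancel₀ (hne ξ)

theorem notMem_spec_opA0 {σ : ℝ} {z : ℂ} (hz : z ∉ halfLines σ) : z ∉ spec (opA0 σ) := by
  obtain ⟨g, hg⟩ := exists_detSymbol_inv hz
  exact (isResolventAt_opA0 hg).notMem_spec

/-- An eigenvector would be killed by the multiplier `detSymbol`. Its zeros satisfy `(σ² + 4π²|ξ|²)²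
= -z²`, which fixes `|ξ|`, so they form a null set. -/
theorem not_isEigenvalue_opA0 (σ : ℝ) (z : ℂ) : ¬ IsEigenvalue (opA0 σ) z := by
  rintro ⟨⟨x, hx⟩, hx0, he⟩
  obtain ⟨h, rfl⟩ := (mem_H2_iff x).mp hx
  refine hx0 ?_
  have e := sub_opA0_bessel σ z h
  simp only at he
  rw [he, sub_self] at e
  have h1 : fourierMul (detSymbol σ z) h = 0 := by
    rw [← shiftedFreeConj_shiftedFree, ← e, map_zero]
  have hD : ∀ ξ, detSymbol σ z ξ = 0 →
      z ^ 2 + ((σ ^ 2 + 4 * Real.pi ^ 2 * ‖ξ‖ ^ 2 : ℝ) : ℂ) ^ 2 = 0 := by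
    intro ξ hξ
    rw [detSymbol_apply, freeSymbol_apply] at hξ
    have h2 : (z ^ 2 + ((σ ^ 2 + 4 * Real.pi ^ 2 * ‖ξ‖ ^ 2 : ℝ) : ℂ) ^ 2) * besselSymbol ξ ^ 2 = 0 := by
      rw [← hξ]
      ring
    exact (mul_eq_zero.mp h2).resolve_right (pow_ne_zero 2 (besselSymbol_ne_zero ξ))
  have hae : ∀ᵐ ξ ∂(volume : Measure Plane), detSymbol σ z ξ ≠ 0 := by
    by_cases hex : ∃ ξ₀, detSymbol σ z ξ₀ = 0
    · obtain ⟨ξ₀, h0⟩ := hex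
      have hs : (volume : Measure Plane) (Metric.sphere 0 ‖ξ₀‖) = 0 := Measure.addHaar_sphere _ _ _
      filter_upwards [measure_eq_zero_iff_ae_notMem.mp hs] with ξ hξ hξ0
      refine hξ (mem_sphere_zero_iff_norm.mpr ?_)
      have h2 : ((σ ^ 2 + 4 * Real.pi ^ 2 * ‖ξ‖ ^ 2 : ℝ) : ℂ) ^ 2 =
          ((σ ^ 2 + 4 * Real.pi ^ 2 * ‖ξ₀‖ ^ 2 : ℝ) : ℂ) ^ 2 := by
        linear_combination hD ξ hξ0 - hD ξ₀ h0
      have h3 : (σ ^ 2 + 4 * Real.pi ^ 2 * ‖ξ‖ ^ 2) ^ 2 =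
          (σ ^ 2 + 4 * Real.pi ^ 2 * ‖ξ₀‖ ^ 2) ^ 2 := by exact_mod_cast h2
      have h4 := (pow_left_inj₀ (by positivity) (by positivity) two_ne_zero).mp h3
      have h5 : ‖ξ‖ ^ 2 = ‖ξ₀‖ ^ 2 := by
        have h6 : 4 * Real.pi ^ 2 * (‖ξ‖ ^ 2 - ‖ξ₀‖ ^ 2) = 0 := by linarith
        have h7 := (mul_eq_zero.mp h6).resolve_left (by positivity)
        linarith
      exact (pow_left_inj₀ (norm_nonneg _) (norm_nonneg _) two_ne_zero).mp h5
    · push Not at hex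
      exact ae_of_all _ hex
  have h2 := eq_zero_of_fourierMul_eq_zero hae h1
  exact (congrArg bessel h2).trans (map_zero bessel)

/-- The eigenvalue `±i` of `J` is chosen opposite in sign to `t`, so that `i t + p μ` vanishes
exactly when `p = |t|`. -/
theorem exists_eigenvector_J (t : ℝ) : ∃ v : Val, ∃ μ : ℂ, v ≠ 0 ∧ act J v = μ • v ∧
    ∀ p : ℝ, ‖I * t + p * μ‖ = |(|t| - p)| := by
  rcases le_total 0 t with ht | ht
  · refine ⟨!₂[1, I], -I, fun h => ?_, ?_, fun p => ?_⟩
    · simpa using congrArg (fun v : Val => v 0) h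
    · ext i
      fin_cases i <;> simp [act_apply, J]
    · have : I * (t : ℂ) + p * -I = I * ((t - p : ℝ) : ℂ) := by push_cast; ring
      rw [this, norm_mul, Complex.norm_I, one_mul, Complex.norm_real, Real.norm_eq_abs,
        abs_of_nonneg ht]
  · refine ⟨!₂[1, -I], I, fun h => ?_, ?_, fun p => ?_⟩
    · simpa using congrArg (fun v : Val => v 0) h
    · ext i
      fin_cases i <;> simp [act_apply, J]
    · have : I * (t : ℂ) + p * I = I * ((t + p : ℝ) : ℂ) := by push_cast; ring
      rw [this, norm_mul, Complex.norm_I, one_mul, Complex.norm_real, Real.norm_eq_abs,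
        abs_of_nonpos ht, ← abs_neg]
      congr 1
      ring

/-- On the half-lines, `z - A₀` has approximate null vectors. -/
theorem exists_approx_null {σ t : ℝ} (ht : σ ^ 2 ≤ |t|) {ε : ℝ} (hε : 0 < ε) :
    ∃ h : L2, h ≠ 0 ∧ ‖shiftedFree σ (I * t) h‖ ≤ ε * ‖bessel h‖ := by
  obtain ⟨v, μ, hv, hJ, hμ⟩ := exists_eigenvector_J t
  let p : Plane → ℝ := fun ξ => σ ^ 2 + 4 * Real.pi ^ 2 * ‖ξ‖ ^ 2
  have hpc : Continuous p := by fun_prop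
  obtain ⟨ξ₀, hξ₀⟩ : ∃ ξ₀ : Plane, p ξ₀ = |t| := by
    have h0 : ‖(EuclideanSpace.single 0 √((|t| - σ ^ 2) / (4 * Real.pi ^ 2)) : Plane)‖ =
        √((|t| - σ ^ 2) / (4 * Real.pi ^ 2)) := by
      rw [PiLp.norm_single, Real.norm_eq_abs, abs_of_nonneg (Real.sqrt_nonneg _)]
    refine ⟨EuclideanSpace.single 0 √((|t| - σ ^ 2) / (4 * Real.pi ^ 2)), ?_⟩
    simp only [p]
    rw [h0, Real.sq_sqrt (div_nonneg (sub_nonneg.mpr ht) (by positivity))]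
    have := Real.pi_ne_zero
    field_simp
    ring
  obtain ⟨δ, hδ, hball⟩ := Metric.continuous_iff.mp hpc ξ₀ ε hε
  let s : Set Plane := Metric.ball ξ₀ δ
  have hs : MeasurableSet s := Metric.isOpen_ball.measurableSet
  have hμs : (volume : Measure Plane) s ≠ ∞ := measure_ball_lt_top.ne
  -- The approximate null vector is concentrated, on the Fourier side, where the eigenvalue of the
  -- symbol is within `ε` of the one at `ξ₀`.
  let k : L2 := indicatorConstLp 2 hs hμs v
  have hk0 : k ≠ 0 := by
    intro h
    have h1 : ‖k‖ = 0 := by rw [h, norm_zero]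
    rw [norm_indicatorConstLp (by norm_num) (by norm_num)] at h1
    have h2 : 0 < (volume : Measure Plane).real s :=
      ENNReal.toReal_pos (Metric.measure_ball_pos _ _ hδ).ne' hμs
    exact (mul_pos (norm_pos_iff.mpr hv) (Real.rpow_pos_of_pos h2 _)).ne' h1
  have hFk : 𝓕 (𝓕⁻ k : L2) = k := FourierTransform.fourier_fourierInv_eq k
  refine ⟨𝓕⁻ k, fun h => hk0 ?_, ?_⟩
  · rw [← hFk, h, FourierTransform.fourier_zero]
  · have h1 : 𝓕 (shiftedFree σ (I * t) (𝓕⁻ k)) =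
        (I * t) • mulOp besselSymbol k + JL2 (mulOp (freeSymbol σ) k) := by
      have e : shiftedFree σ (I * t) (𝓕⁻ k) = (I * t) • fourierMul besselSymbol (𝓕⁻ k) +
        JL2 (fourierMul (freeSymbol σ) (𝓕⁻ k)) := rfl
      rw [e, FourierTransform.fourier_add, FourierTransform.fourier_smul, fourier_JL2,
        fourier_fourierMul, fourier_fourierMul, hFk]
    have h2 : 𝓕 (bessel (𝓕⁻ k)) = mulOp besselSymbol k := by
      rw [bessel, fourier_fourierMul, hFk]
    rw [← Lp.norm_fourier_eq, ← Lp.norm_fourier_eq (bessel _), h1, h2]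
    refine Lp.norm_le_mul_norm_of_ae_le_mul ?_
    filter_upwards [mulOp_coeFn besselSymbol k, mulOp_coeFn (freeSymbol σ) k,
      JL2_coeFn (mulOp (freeSymbol σ) k), Lp.coeFn_smul (I * (t : ℂ)) (mulOp besselSymbol k),
      Lp.coeFn_add ((I * (t : ℂ)) • mulOp besselSymbol k) (JL2 (mulOp (freeSymbol σ) k)),
      indicatorConstLp_coeFn (p := 2) (hs := hs) (hμs := hμs) (c := v)] with ξ a1 a2 a3 a4 a5 a6
    rw [a5, Pi.add_apply, a4, Pi.smul_apply, a3, a1, a2]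
    have a6' : k ξ = s.indicator (fun _ => v) ξ := a6
    rw [a6']
    by_cases hξ : ξ ∈ s
    · rw [Set.indicator_of_mem hξ, freeSymbol_apply, map_smul, hJ]
      have e : (I * (t : ℂ)) • besselSymbol ξ • v + (((p ξ : ℝ) : ℂ) * besselSymbol ξ) • μ • v =
          (I * t + p ξ * μ) • besselSymbol ξ • v := by module
      refine (congrArg norm e).trans_le ?_
      rw [norm_smul, hμ]
      gcongr
      rw [abs_sub_comm, ← hξ₀]
      exact (hball ξ hξ).le
    · rw [Set.indicator_of_notMem hξ]
      simp

theorem mem_spec_opA0 {σ : ℝ} {z : ℂ} (hz : z ∈ halfLines σ) : z ∈ spec (opA0 σ) := by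
  obtain ⟨t, ht, rfl⟩ := hz
  rintro ⟨R, hR⟩
  -- With this `ε`, `‖R‖ ε ≤ 1/2`, so a resolvent `R` would force `‖bessel h‖ ≤ ‖bessel h‖ / 2`.
  obtain ⟨h, hh0, hh⟩ := exists_approx_null ht (ε := 1 / (2 * (‖R‖ + 1))) (by positivity)
  have h1 := hR.2 ⟨bessel h, bessel_mem_H2 h⟩
  simp only at h1
  rw [sub_opA0_bessel] at h1
  have h2 : ‖bessel h‖ ≤ ‖R‖ * (1 / (2 * (‖R‖ + 1)) * ‖bessel h‖) := by
    conv_lhs => rw [← h1]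
    exact R.le_of_opNorm_le_of_le le_rfl hh
  have h3 : ‖R‖ * (1 / (2 * (‖R‖ + 1)) * ‖bessel h‖) ≤ 1 / 2 * ‖bessel h‖ := by
    rw [← mul_assoc]
    gcongr
    rw [mul_one_div, div_le_iff₀ (by positivity)]
    linarith [norm_nonneg R]
  have h4 : ‖bessel h‖ = 0 := by linarith [norm_nonneg (bessel h)]
  exact hh0 (eq_zero_of_fourierMul_eq_zero (ae_of_all _ besselSymbol_ne_zero)
    (norm_eq_zero.mp h4))

theorem spec_opA0 (σ : ℝ) : spec (opA0 σ) = halfLines σ :=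
  Set.Subset.antisymm (fun _ hz => by_contra fun h => notMem_spec_opA0 h hz)
    fun _ hz => mem_spec_opA0 hz

theorem ofReal_notMem_halfLines {σ : ℝ} (hσ : 0 < σ) (x : ℝ) : (x : ℂ) ∉ halfLines σ := by
  rintro ⟨t, ht, h⟩
  have h1 := congrArg Complex.im h
  simp at h1
  rw [← h1, abs_zero] at ht
  have : 0 < σ ^ 2 := by positivity
  linarith

theorem isPreconnected_compl_halfLines {σ : ℝ} (hσ : 0 < σ) : IsPreconnected (halfLines σ)ᶜ := by
  -- If `a z` with `0 < a ≤ 1` lies on a half-line, so does `z`, which is farther out.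
  have hs : StarConvex ℝ 0 (halfLines σ)ᶜ := by
    rw [starConvex_zero_iff]
    rintro z hz a ha0 ha1 ⟨t, ht, hat⟩
    have hσ2 : 0 < σ ^ 2 := by positivity
    rcases ha0.eq_or_lt with h | h
    · rw [← h, zero_smul] at hat
      have ht0 : t = 0 := by
        have := mul_eq_zero.mp hat.symm
        simpa using this
      rw [ht0, abs_zero] at ht
      linarith
    · refine hz ⟨t / a, ?_, ?_⟩
      · rw [abs_div, abs_of_pos h, le_div_iff₀ h]
        nlinarith
      · have ha : (a : ℂ) ≠ 0 := by exact_mod_cast h.ne'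
        rw [Complex.real_smul] at hat
        push_cast
        field_simp
        rw [mul_comm]
        exact hat
  have h0 : (0 : ℂ) ∈ (halfLines σ)ᶜ := by
    simpa using ofReal_notMem_halfLines hσ 0
  exact (StarConvex.isPathConnected hs h0).isConnected.isPreconnected

/-- With `q` and `l` the Bessel and free symbols, the resolvent has symbol `(x q² - J q l) / (x² q²
+ l²)`. Each of the two parts is at most `1 / x`, the second by `2 x q l ≤ x² q² + l²`. -/
theorem norm_resolventOp_opA0_le {σ x : ℝ} (hσ : 0 < σ) (hx : 0 < x) :
    ‖resolventOp (opA0 σ) (x : ℂ)‖ ≤ 2 / x := by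
  obtain ⟨g, hg⟩ := exists_detSymbol_inv (ofReal_notMem_halfLines hσ x)
  rw [(isResolventAt_opA0 hg).resolventOp_eq]
  have e : bessel ∘L shiftedFreeConj σ x ∘L fourierMul g =
      fourierMul ((x : ℂ) • (besselSymbol * (besselSymbol * g))) -
        JL2 ∘L fourierMul (besselSymbol * (freeSymbol σ * g)) := by
    ext1 f
    have h2 : bessel (JL2 (fourierMul (freeSymbol σ) (fourierMul g f))) =
      JL2 (bessel (fourierMul (freeSymbol σ) (fourierMul g f))) := fourierMul_JL2 _ _
    simp only [ContinuousLinearMap.comp_apply, shiftedFreeConj, sub_apply, smul_apply, map_sub,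
      map_smul, fourierMul_smul, fourierMul_mul]
    rw [h2]
    rfl
  have hpt : ∀ ξ, ∃ q l : ℝ, 0 < q ∧ 0 ≤ l ∧ besselSymbol ξ = q ∧ freeSymbol σ ξ = l ∧
      g ξ = (((x ^ 2 * q ^ 2 + l ^ 2)⁻¹ : ℝ) : ℂ) := by
    intro ξ
    have hq : 0 < (1 + ‖ξ‖ ^ 2)⁻¹ := by positivity
    refine ⟨(1 + ‖ξ‖ ^ 2)⁻¹, (σ ^ 2 + 4 * Real.pi ^ 2 * ‖ξ‖ ^ 2) * (1 + ‖ξ‖ ^ 2)⁻¹, hq,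
      by positivity, besselSymbol_apply ξ, ?_, ?_⟩
    · rw [freeSymbol_apply, besselSymbol_apply, ← Complex.ofReal_mul]
    · have h1 : detSymbol σ x ξ * g ξ = 1 := DFunLike.congr_fun hg ξ
      rw [detSymbol_apply, freeSymbol_apply, besselSymbol_apply] at h1
      rw [eq_inv_of_mul_eq_one_right h1]
      push_cast
      rfl
  have hn1 : ‖fourierMul ((x : ℂ) • (besselSymbol * (besselSymbol * g)))‖ ≤ 1 / x := by
    refine norm_fourierMul_le (by positivity) fun ξ => ?_
    obtain ⟨q, l, hq, hl, e1, e2, e3⟩ := hpt ξ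
    have : ((x : ℂ) • (besselSymbol * (besselSymbol * g))) ξ =
      (x : ℂ) * (besselSymbol ξ * (besselSymbol ξ * g ξ)) := rfl
    rw [this, e1, e3]
    norm_cast
    rw [Real.norm_eq_abs, abs_of_nonneg (by positivity), ← mul_assoc, ← mul_assoc, ← div_eq_mul_inv,
      div_le_div_iff₀ (by positivity) hx]
    nlinarith [sq_nonneg l]
  have hn2 : ‖fourierMul (besselSymbol * (freeSymbol σ * g))‖ ≤ 1 / x := by
    refine norm_fourierMul_le (by positivity) fun ξ => ?_
    obtain ⟨q, l, hq, hl, e1, e2, e3⟩ := hpt ξ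
    have : (besselSymbol * (freeSymbol σ * g)) ξ =
      besselSymbol ξ * (freeSymbol σ ξ * g ξ) := rfl
    rw [this, e1, e2, e3]
    norm_cast
    rw [Real.norm_eq_abs, abs_of_nonneg (by positivity), ← mul_assoc, ← div_eq_mul_inv,
      div_le_div_iff₀ (by positivity) hx]
    nlinarith [sq_nonneg (x * q - l), mul_pos hx hq, mul_nonneg (mul_pos hx hq).le hl]
  rw [e]
  refine (norm_sub_le _ _).trans ?_
  have hn3 : ‖JL2 ∘L fourierMul (besselSymbol * (freeSymbol σ * g))‖ ≤ 1 * (1 / x) :=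
    (ContinuousLinearMap.opNorm_comp_le _ _).trans
      (mul_le_mul norm_JL2_le hn2 (norm_nonneg _) zero_le_one)
  calc _ ≤ 1 / x + 1 * (1 / x) := add_le_add hn1 hn3
    _ = 2 / x := by ring

end FreeOperator

/-! ### The spectrum of the linearized operator. -/

section Linearization

/-- The bounded perturbation `A - A₀`. -/
def Wave.perturbation (P : Wave) : L2 →L[ℂ] L2 := JL2 ∘L P.potentialL

theorem opA_eq (P : Wave) (x : L2) (hx : x ∈ (opA0 P.σ).domain) (hx' : x ∈ P.opA.domain) :
    P.opA ⟨x, hx'⟩ = opA0 P.σ ⟨x, hx⟩ + P.perturbation x := by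
  have e : P.opA ⟨x, hx'⟩ = JL2 (lap ⟨x, hx⟩ - ((P.σ : ℂ) ^ 2) • x + P.potential x) := rfl
  rw [e, map_add]
  rfl

theorem isCompactOperator_perturbation (P : Wave) {z : ℂ} (hz : z ∉ spec (opA0 P.σ)) :
    IsCompactOperator (P.perturbation ∘L resolventOp (opA0 P.σ) z) := by
  rw [spec_opA0] at hz
  obtain ⟨g, hg⟩ := exists_detSymbol_inv hz
  rw [(isResolventAt_opA0 hg).resolventOp_eq]
  exact ((isCompactOperator_potentialL_bessel P).clm_comp JL2).comp_clm
    (shiftedFreeConj P.σ z ∘L fourierMul g)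

/-- The part of Weyl's theorem needed here; absence of eigenvalues of `A₀` replaces any index
argument. The point `0` serves as reference point in the resolvent set of `A₀`, since `σ > 0`. -/
theorem halfLines_subset_spec_opA (P : Wave) : halfLines P.σ ⊆ spec P.opA := by
  intro z hz
  by_contra h
  have h0 : ((0 : ℝ) : ℂ) ∉ spec (opA0 P.σ) := notMem_spec_opA0 (ofReal_notMem_halfLines P.σ_pos 0)
  exact not_isEigenvalue_opA0 P.σ z (isEigenvalue_of_notMem_spec (T₀ := opA0 P.σ) (T := P.opA) rfl (opA_eq P) h0
    (isCompactOperator_perturbation P h0) (mem_spec_opA0 hz) h)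

theorem mem_specDisc_opA (P : Wave) {z : ℂ} (hz : z ∈ spec P.opA) (hz₀ : z ∉ halfLines P.σ) :
    z ∈ specDisc P.opA := by
  -- Chosen so that `‖B‖ · 2 / x < 1`, the starting point for the analytic Fredholm theorem.
  set x : ℝ := 2 * ‖P.perturbation‖ + 1 with hx
  have hx0 : 0 < x := by positivity
  have hw : (x : ℂ) ∉ spec (opA0 P.σ) := notMem_spec_opA0 (ofReal_notMem_halfLines P.σ_pos x)
  refine mem_specDisc_of_notMem_spec (T₀ := opA0 P.σ) (T := P.opA) rfl (opA_eq P)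
    (fun z hz => isCompactOperator_perturbation P hz) ?_ hw ?_ hz (notMem_spec_opA0 hz₀)
  · rw [spec_opA0]
    exact isPreconnected_compl_halfLines P.σ_pos
  · calc ‖P.perturbation ∘L resolventOp (opA0 P.σ) x‖
        ≤ ‖P.perturbation‖ * ‖resolventOp (opA0 P.σ) x‖ := ContinuousLinearMap.opNorm_comp_le _ _
      _ ≤ ‖P.perturbation‖ * (2 / x) := by
          gcongr
          exact norm_resolventOp_opA0_le P.σ_pos hx0
      _ < 1 := by
          rw [← mul_div_assoc, div_lt_one hx0]
          linarith

theorem notMem_specDisc_opA (P : Wave) {z : ℂ} (hz : z ∈ halfLines P.σ) :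
    z ∉ specDisc P.opA := by
  rintro ⟨-, -, r, hr, hball, -⟩
  obtain ⟨t, ht, rfl⟩ := hz
  -- Moving outward from `i t` by exactly `r` stays on the half-line and in the closed ball, so `i
  -- t` is not isolated.
  obtain ⟨s, hs, hst⟩ : ∃ s : ℝ, P.σ ^ 2 ≤ |t + s| ∧ |s| = r := by
    rcases le_total 0 t with h | h
    · refine ⟨r, ?_, abs_of_pos hr⟩
      rw [abs_of_nonneg (by linarith)]
      rw [abs_of_nonneg h] at ht
      linarith
    · refine ⟨-r, ?_, by rw [abs_neg, abs_of_pos hr]⟩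
      rw [abs_of_nonpos (by linarith)]
      rw [abs_of_nonpos h] at ht
      linarith
  have hd : I * ((t + s : ℝ) : ℂ) - I * t = I * s := by
    push_cast
    ring
  have hmem : I * ((t + s : ℝ) : ℂ) ∈ Metric.closedBall (I * (t : ℂ)) r ∩ spec P.opA := by
    refine ⟨?_, halfLines_subset_spec_opA P ⟨t + s, hs, rfl⟩⟩
    rw [Metric.mem_closedBall, dist_eq_norm, hd, norm_mul, Complex.norm_I, one_mul,
      Complex.norm_real, Real.norm_eq_abs, hst]
  rw [hball, Set.mem_singleton_iff, ← sub_eq_zero, hd] at hmem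
  have hs0 : s = 0 := by simpa using hmem
  rw [hs0, abs_zero] at hst
  exact hr.ne hst

theorem specEss_opA (P : Wave) : specEss P.opA = halfLines P.σ := by
  ext z
  constructor
  · rintro ⟨h1, h2⟩
    by_contra h3
    exact h2 (mem_specDisc_opA P h1 h3)
  · intro h
    exact ⟨halfLines_subset_spec_opA P h, notMem_specDisc_opA P h⟩

end Linearization

end NLS

end

theorem lemma3p1 (P : NLS.Wave) :
    NLS.spec P.opA = NLS.specDisc P.opA ∪ NLS.specEss P.opA ∧
    (∀ z ∈ NLS.specEss P.opA, z.re = 0) ∧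
    NLS.specEss P.opA = NLS.spec (NLS.opA0 P.σ) ∧
    NLS.spec (NLS.opA0 P.σ) = {z : ℂ | ∃ t : ℝ, P.σ ^ 2 ≤ |t| ∧ z = Complex.I * t} := by
  refine ⟨(Set.union_sdiff_cancel fun z hz => hz.1).symm, ?_, ?_, NLS.spec_opA0 P.σ⟩
  · rw [NLS.specEss_opA]
    rintro _ ⟨t, -, rfl⟩
    simp
  · rw [NLS.specEss_opA, NLS.spec_opA0]
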